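/- **Setting.** Let $M<N$. For $n=1,\dots,N$ consider the process $x_n(t+1)=A_nx_n(t)+w_n(t)$, $y_n(t)=C_nx_n(t)+v_n(t)$ in $\mathbb R^{l_n}$, $\mathbb R^{r_n}$, where $(w_n(t))_t$ and $(v_n(t))_t$ are i.i.d. zero-mean Gaussian with covariances $W_n$ and $V_n$, numbered so that $\rho(A_1)\ge\dots\ge\rho(A_N)$; $\rho(\cdot)$ denotes the spectral radius and $\rho_{\max}:=\rho(A_1)$. Sensor $n$ runs a stable Kalman filter in steady state: $\bar P_n\succeq 0$ satisfies $\bar P_n=(I-K_nC_n)P_n^-$ with $P_n^-=A_n\bar P_nA_n^\top+W_n$ and $K_n=P_n^-C_n^\top(C_nP_n^-C_n^\top+V_n)^{-1}$ (the inverse exists), $\rho((I-K_nC_n)A_n)<1$, and the local estimate $x^s_n(t+1)=A_nx^s_n(t)+K_n\big(y_n(t+1)-C_nA_nx^s_n(t)\big)$ has initial error covariance $\mathsf E[(x^s_n(0)-x_n(0))(x^s_n(0)-x_n(0))^\top]=\bar P_n$. There are $M$ channels. Their joint state $\mathbf h(t)$ is an irreducible aperiodic Markov chain on a set $\{\mathbf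 h_1,\dots,\mathbf h_{\bar M}\}\subseteq\{0,1\}^M$ of distinct vectors ($1$ = on, $0$ = off) with transition matrix $\mathbf M=(p_{i,j})$ and any initial law. The initial data of each process and its filter, the noises and the channel chain are independent. In each slot $t\ge1$ a deterministic stationary policy $\pi$ assigns to each channel at most one sensor, as a function of the ages of information $\phi_1(t),\dots,\phi_N(t)$ and of the previous channel state $\mathbf h(t-1)$ only; the packet $x^s_n(t)$ of one sensor may be sent over several channels. It is received, $\gamma_n(t)=1$, if at least one channel assigned to sensor $n$ is on in state $\mathbf h(t)$; otherwise $\gamma_n(t)=0$. The ages satisfy $\phi_n(1)=1$, and $\phi_n(t+1)=1$ if $\gamma_n(t)=1$, $\phi_n(t+1)=\phi_n(t)+1$ otherwise. The remote estimate is $\hat x_n(1)=A_nx_n^s(0)$ and, for $t\ge1$, $\hat x_n(t+1)=A_nx^s_n(t)$ if $\gamma_n(t)=1$, $\hat x_n(t+1)=A_n\hat x_n(t)$ otherwise. Let $$J_n=\limsup_{T\to\infty}\frac1T\sum_{t=1}^T\mathsf E\,\|\hat x_n(t)-x_n(t)\|^2,\qquad J=\sum_{n=1}^NJ_n .$$ The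 remote estimator is called *stable* (average mean-square stabilizable) if $J<\infty$ for some such policy $\pi$. **Theorem.** The remote estimator is stable if and only if $$\rho_{\max}^2\,\rho(\mathbf M')<1,$$ where $\mathbf M'$ is the $\bar M\times\bar M$ matrix with $[\mathbf M']_{i,j}=p_{i,j}$ if $\mathbf h_j=(0,\dots,0)$ and $[\mathbf M']_{i,j}=0$ otherwise. -/

import Mathlib

open MeasureTheory ProbabilityTheory Filter Matrix
open scoped ENNReal

namespace RemoteEst

/-- The spectral radius of a real square matrix: the largest absolute value of its (complex)
eigenvalues, as an element of `[0, ∞]` (it is always finite). -/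
noncomputable def specRad {k : ℕ} (A : Matrix (Fin k) (Fin k) ℝ) : ℝ≥0∞ :=
  spectralRadius ℂ (A.map (fun a : ℝ => (a : ℂ)))

/-- Prior error covariance `A P Aᵀ + W` of a Kalman filter with posterior error covariance `P`. -/
noncomputable def priorCov {l : ℕ} (A W P : Matrix (Fin l) (Fin l) ℝ) :
    Matrix (Fin l) (Fin l) ℝ :=
  A * P * Aᵀ + W

/-- Innovation covariance `C P⁻ Cᵀ + V`, where `P⁻` is the prior error covariance. -/
noncomputable def innovationCov {l r : ℕ} (A W P : Matrix (Fin l) (Fin l) ℝ)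
    (C : Matrix (Fin r) (Fin l) ℝ) (V : Matrix (Fin r) (Fin r) ℝ) : Matrix (Fin r) (Fin r) ℝ :=
  C * priorCov A W P * Cᵀ + V

/-- Kalman gain `P⁻ Cᵀ (C P⁻ Cᵀ + V)⁻¹`. -/
noncomputable def kalmanGain {l r : ℕ} (A W P : Matrix (Fin l) (Fin l) ℝ)
    (C : Matrix (Fin r) (Fin l) ℝ) (V : Matrix (Fin r) (Fin r) ℝ) : Matrix (Fin l) (Fin r) ℝ :=
  priorCov A W P * Cᵀ * (innovationCov A W P C V)⁻¹

/-- A process `x(t+1) = A x(t) + w(t)`, `y(t) = C x(t) + v(t)` with noise covariances `W`, `V`,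
together with a stable local Kalman filter in steady state with error covariance `P`:
the filter equations are meaningful (the innovation covariance is invertible), `P` is a fixed
point of the covariance recursion, and the estimation error recursion
`e(t+1) = (I - K C) A e(t) + noise` of the filter is stable. -/
structure SensorModel where
  /-- dimension of the process state -/
  l : ℕ
  /-- dimension of the measurement -/
  r : ℕ
  A : Matrix (Fin l) (Fin l) ℝ
  C : Matrix (Fin r) (Fin l) ℝ
  W : Matrix (Fin l) (Fin l) ℝ
  V : Matrix (Fin r) (Fin r) ℝ
  P : Matrix (Fin l) (Fin l) ℝ
  W_posSemidef : W.PosSemidef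
  V_posSemidef : V.PosSemidef
  P_posSemidef : P.PosSemidef
  innovation_invertible : IsUnit (innovationCov A W P C V).det
  steady_state : P = (1 - kalmanGain A W P C V * C) * priorCov A W P
  filter_stable : specRad ((1 - kalmanGain A W P C V * C) * A) < 1

/-- The steady-state Kalman gain of the local filter. -/
noncomputable def SensorModel.gain (s : SensorModel) : Matrix (Fin s.l) (Fin s.r) ℝ :=
  kalmanGain s.A s.W s.P s.C s.V

/-- A Markov model of `M` parallel on-off channels with `K` distinct vector states: `state i m` is
`true` if channel `m` is on (transmission succeeds) in the `i`-th vector state.  The chain of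
vector states has transition matrix `T` and is irreducible and aperiodic (for every state, the
greatest common divisor of the possible return times is `1`). -/
structure ChannelModel (M K : ℕ) where
  state : Fin K → Fin M → Bool
  T : Matrix (Fin K) (Fin K) ℝ
  state_injective : Function.Injective state
  row_sum : ∀ i, ∑ j, T i j = 1
  irreducible : T.IsIrreducible
  aperiodic : ∀ (i : Fin K) (d : ℕ), (∀ k, 1 ≤ k → 0 < (T ^ k) i i → d ∣ k) → d = 1

namespace ChannelModel

variable {M K : ℕ}

/-- The transition matrix restricted to the columns of the states which are not all-off. -/
def onPart (c : ChannelModel M K) : Matrix (Fin K) (Fin K) ℝ :=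
  Matrix.of fun i j => if ∀ m, c.state j m = false then 0 else c.T i j

/-- The transition matrix with every column zeroed except that of the all-off state. -/
def offPart (c : ChannelModel M K) : Matrix (Fin K) (Fin K) ℝ :=
  c.T - c.onPart

end ChannelModel

/-- A deterministic stationary scheduling policy with redundant transmissions.  From the current
ages of information and the (index of the) previous vector channel state it chooses, for every
channel, the packet to be sent over it (`none`: the channel is idle).  A channel carries at most
one packet, but the same packet may be sent over several channels. -/
abbrev Policy (N M K : ℕ) : Type :=
  (Fin N → ℕ) → Fin K → Fin M → Option (Fin N)

section Dynamics

variable {N M K : ℕ}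

/-- The packet of sensor `n` arrives when the ages of information are `φ`, the previous channel
state is `i` and the current channel state is `j`: at least one channel assigned to it is on. -/
def Arrives (c : ChannelModel M K) (π : Policy N M K) (φ : Fin N → ℕ) (i j : Fin K)
    (n : Fin N) : Prop :=
  ∃ m, π φ i m = some n ∧ c.state j m = true

open Classical in
/-- Age of information `φ n (t)` along a channel path `h`.  Scheduling starts in slot `1`, where
all ages are `1`; the value at `t = 0` is not used. -/
noncomputable def aoi (c : ChannelModel M K) (π : Policy N M K) (h : ℕ → Fin K) :
    ℕ → Fin N → ℕ
  | 0 => fun _ => 0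
  | 1 => fun _ => 1
  | t + 2 => fun n =>
      if Arrives c π (aoi c π h (t + 1)) (h t) (h (t + 1)) n then 1
      else aoi c π h (t + 1) n + 1

/-- `Received c π h t n`: the packet sent by sensor `n` in slot `t` is received.  Time `0` is the
initial reception (so that the ages in slot `1` are `1`). -/
def Received (c : ChannelModel M K) (π : Policy N M K) (h : ℕ → Fin K) : ℕ → Fin N → Prop
  | 0 => fun _ => True
  | t + 1 => fun n => Arrives c π (aoi c π h (t + 1)) (h t) (h (t + 1)) n

end Dynamics

/-- The independent sources of randomness: the initial data of each process and its local filter,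
the process noise, the measurement noise in the slots `t + 1`, and the channel. -/
inductive Source (N : ℕ) : Type
  | init (n : Fin N)
  | process (n : Fin N) (t : ℕ)
  | measurement (n : Fin N) (t : ℕ)
  | channel

/-- `w` is a zero-mean Gaussian random vector with covariance matrix `W`. -/
def IsCenteredGaussian {Ω : Type*} [MeasurableSpace Ω] (μ : Measure Ω) {k : ℕ}
    (w : Ω → Fin k → ℝ) (W : Matrix (Fin k) (Fin k) ℝ) : Prop :=
  IsGaussian (μ.map w) ∧ (∀ i, ∫ ω, w ω i ∂μ = 0) ∧ ∀ i j, ∫ ω, w ω i * w ω j ∂μ = W i j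

/-- The random data driving the system: the channel chain `h` (`h t` is the index of the vector
channel state in slot `t`), the initial process states `x₀`, the initial local estimates `xs₀`, the
process noises `w` and the measurement noises `v`. -/
structure Randomness {N M K : ℕ} (sensor : Fin N → SensorModel) (c : ChannelModel M K)
    {Ω : Type*} [MeasurableSpace Ω] (μ : Measure Ω) where
  h : ℕ → Ω → Fin K
  x₀ : ∀ n, Ω → Fin (sensor n).l → ℝ
  xs₀ : ∀ n, Ω → Fin (sensor n).l → ℝ
  w : ∀ n, ℕ → Ω → Fin (sensor n).l → ℝ
  v : ∀ n, ℕ → Ω → Fin (sensor n).r → ℝ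
  measurable_h : ∀ t, Measurable (h t)
  measurable_x₀ : ∀ n, Measurable (x₀ n)
  measurable_xs₀ : ∀ n, Measurable (xs₀ n)
  measurable_w : ∀ n t, Measurable (w n t)
  measurable_v : ∀ n t, Measurable (v n t)
  /-- `h` is a time-homogeneous Markov chain with transition matrix `c.T` (and any initial law). -/
  markov : ∀ (t : ℕ) (s : ℕ → Fin K),
    μ {ω | ∀ u ≤ t + 1, h u ω = s u} =
      μ {ω | ∀ u ≤ t, h u ω = s u} * ENNReal.ofReal (c.T (s t) (s (t + 1)))
  gaussian_w : ∀ n t, IsCenteredGaussian μ (w n t) (sensor n).W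
  gaussian_v : ∀ n t, IsCenteredGaussian μ (v n t) (sensor n).V
  /-- The local filters start in steady state: the initial error is square integrable and has
  the steady-state error covariance. -/
  memLp_init : ∀ n i, MemLp (fun ω => xs₀ n ω i - x₀ n ω i) 2 μ
  cov_init : ∀ n i j,
    ∫ ω, (xs₀ n ω i - x₀ n ω i) * (xs₀ n ω j - x₀ n ω j) ∂μ = (sensor n).P i j
  /-- All sources of randomness are independent. -/
  indep : iIndep (fun s : Source N => match s with
    | .init n => MeasurableSpace.comap (fun ω => (x₀ n ω, xs₀ n ω)) inferInstance
    | .process n t => MeasurableSpace.comap (w n t) inferInstance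
    | .measurement n t => MeasurableSpace.comap (v n (t + 1)) inferInstance
    | .channel => MeasurableSpace.comap (fun ω t => h t ω) inferInstance) μ

namespace Randomness

variable {N M K : ℕ} {sensor : Fin N → SensorModel} {c : ChannelModel M K}
  {Ω : Type*} [MeasurableSpace Ω] {μ : Measure Ω} (R : Randomness sensor c μ)

/-- Process state: `x(t+1) = A x(t) + w(t)`. -/
noncomputable def x (n : Fin N) : ℕ → Ω → Fin (sensor n).l → ℝ
  | 0 => R.x₀ n
  | t + 1 => fun ω => (sensor n).A *ᵥ x n t ω + R.w n t ω

/-- Measurement: `y(t) = C x(t) + v(t)`. -/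
noncomputable def y (n : Fin N) (t : ℕ) (ω : Ω) : Fin (sensor n).r → ℝ :=
  (sensor n).C *ᵥ R.x n t ω + R.v n t ω

/-- Local (steady-state) Kalman filter estimate:
`xˢ(t+1) = A xˢ(t) + K (y(t+1) - C A xˢ(t))`. -/
noncomputable def xs (n : Fin N) : ℕ → Ω → Fin (sensor n).l → ℝ
  | 0 => R.xs₀ n
  | t + 1 => fun ω =>
      (sensor n).A *ᵥ xs n t ω +
        (sensor n).gain *ᵥ (R.y n (t + 1) ω - (sensor n).C *ᵥ ((sensor n).A *ᵥ xs n t ω))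

open Classical in
/-- Remote estimate: `x̂(t+1) = A xˢ(t)` if the packet of slot `t` is received, and
`x̂(t+1) = A x̂(t)` otherwise. -/
noncomputable def xhat (π : Policy N M K) (n : Fin N) : ℕ → Ω → Fin (sensor n).l → ℝ
  | 0 => R.xs₀ n
  | t + 1 => fun ω =>
      if Received c π (fun u => R.h u ω) t n then (sensor n).A *ᵥ R.xs n t ω
      else (sensor n).A *ᵥ xhat π n t ω

/-- The expected trace of the remote estimation error covariance of process `n` in slot `t`, that
is, the mean-square error `E ‖x̂(t) - x(t)‖²`, as an element of `[0, ∞]`. -/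
noncomputable def mse (π : Policy N M K) (n : Fin N) (t : ℕ) : ℝ≥0∞ :=
  ∫⁻ ω, ENNReal.ofReal (∑ i, (R.xhat π n t ω i - R.x n t ω i) ^ 2) ∂μ

/-- Long-run average mean-square error `J n = limsup_T (1/T) ∑_{t=1}^T E Tr P n (t)`. -/
noncomputable def avgMSE (π : Policy N M K) (n : Fin N) : ℝ≥0∞ :=
  limsup (fun T : ℕ => (∑ t ∈ Finset.Icc 1 T, R.mse π n t) / (T : ℝ≥0∞)) atTop

/-- The remote estimator is (average mean-square) stabilizable: some deterministic stationary
policy makes the sum of the long-run average mean-square errors finite. -/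
def IsStabilizable : Prop :=
  ∃ π : Policy N M K, ∑ n, R.avgMSE π n < ∞

end Randomness

end RemoteEst

/-! The remote error is the error of open-loop prediction from the last received local estimate, and
the channel is independent of the processes. Hence the mean-square error is the expected trace of
`openCov` at the current age (`mse_eq`). With gain `K` and innovation covariance `S`, `openCov k = P
+ ∑_{i<k} Aⁱ K S Kᵀ (Aⁱ)ᵀ`. Its trace is at most of order `∑_{i<k} q^(2i)` for every `q > ρ(A)`,
plus a constant. If `z` is an eigenvalue of `A` with `‖z‖ ≥ 1`, the trace is at least of order
`∑_{i<k} ‖z‖^(2i)`: a left eigenvector `v` with `v K = 0` would also be one of `(1 - K C) A`,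
against the stability of the filter. Only the tails of the ages remain to be estimated. As the
channel states are distinct, at most one state `o` is all-off, and `ρ(M')` is its holding
probability `p`, or `0` if there is none.

Necessity (`tendsto_mse_nhds_top`). Under any policy nothing arrives during a run of `o`, so every
age exceeds the length of the run. If `ρ_max² p ≥ 1`, the growth of the covariance outweighs the
probability `p^m` of a long run, and the error in slot `t + 1` is at least a constant times the
expected number of visits to `o` in slots `1, …, t`. This diverges by irreducibility, so the case of
equality is covered too.

Sufficiency (`exists_mse_maxAgePolicy_le`). Every channel carries the packet of an oldest sensor.
While sensor `n` waits, each slot with a channel on serves a sensor that was not younger than `n`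
and becomes younger, so an age above `k` leaves fewer than `N` such slots among the last `k`. The
probability of this is `O(r^k)` for every `r > p`. Choosing `q > ρ_max` and `r > p` with `q² r < 1`
bounds the errors by a geometric series. -/

namespace RemoteEst

/-! ### Spectral radius: left eigenvectors and growth of powers. -/

section SpectralRadius

/-- The spectrum of a matrix consists of the eigenvalues of its left eigenvectors. -/
theorem mem_spectrum_iff_exists_vecMul {k : ℕ} (A : Matrix (Fin k) (Fin k) ℂ) (z : ℂ) :
    z ∈ spectrum ℂ A ↔ ∃ v : Fin k → ℂ, v ≠ 0 ∧ v ᵥ* A = z • v := by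
  rw [spectrum.mem_iff, Matrix.isUnit_iff_isUnit_det, isUnit_iff_ne_zero, not_not,
    ← Matrix.exists_vecMul_eq_zero_iff]
  refine exists_congr fun v => and_congr_right fun _ => ?_
  rw [Matrix.vecMul_sub, sub_eq_zero, Algebra.algebraMap_eq_smul_one, Matrix.vecMul_smul,
    Matrix.vecMul_one]
  exact eq_comm

/-- Left eigenvectors are the useful ones: if `v K = 0`, then `v` does not see the correction `K C`
in `(1 - K C) A`. -/
theorem le_specRad_of_vecMul {k : ℕ} {A : Matrix (Fin k) (Fin k) ℝ} {z : ℂ} {v : Fin k → ℂ}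
    (hv : v ≠ 0) (h : v ᵥ* A.map (fun a : ℝ => (a : ℂ)) = z • v) :
    (‖z‖₊ : ℝ≥0∞) ≤ specRad A :=
  le_iSup₂ (α := ℝ≥0∞) (f := fun (z : ℂ) (_ : z ∈ spectrum ℂ (A.map (fun a : ℝ => (a : ℂ)))) =>
    (‖z‖₊ : ℝ≥0∞)) z ((mem_spectrum_iff_exists_vecMul _ z).2 ⟨v, hv, h⟩)

attribute [local instance] Matrix.linftyOpNormedRing Matrix.linftyOpNormedAlgebra

/-- The spectral radius is attained at an eigenvalue. -/
theorem exists_vecMul_of_specRad_ne_zero {k : ℕ} {A : Matrix (Fin k) (Fin k) ℝ}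
    (h : specRad A ≠ 0) :
    ∃ (z : ℂ) (v : Fin k → ℂ), v ≠ 0 ∧ v ᵥ* A.map (fun a : ℝ => (a : ℂ)) = z • v ∧
      (‖z‖₊ : ℝ≥0∞) = specRad A := by
  have hne : (spectrum ℂ (A.map (fun a : ℝ => (a : ℂ)))).Nonempty := by
    by_contra hcon
    rw [Set.not_nonempty_iff_eq_empty] at hcon
    exact h (by simp [specRad, spectralRadius, hcon])
  obtain ⟨z, hz, hz'⟩ := spectrum.exists_nnnorm_eq_spectralRadius_of_nonempty hne
  obtain ⟨v, hv, hv'⟩ := (mem_spectrum_iff_exists_vecMul _ z).1 hz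
  exact ⟨z, v, hv, hv', hz'⟩

theorem specRad_ne_top {k : ℕ} (A : Matrix (Fin k) (Fin k) ℝ) : specRad A ≠ ∞ := by
  by_cases h : specRad A = 0
  · simp [h]
  · obtain ⟨z, v, -, -, hz⟩ := exists_vecMul_of_specRad_ne_zero h
    rw [← hz]; exact ENNReal.coe_ne_top

/-- The entries of the powers of a matrix grow at most at any rate above its spectral radius. -/
theorem exists_abs_pow_apply_le {k : ℕ} {A : Matrix (Fin k) (Fin k) ℝ} {q : ℝ}
    (hq : specRad A < ENNReal.ofReal q) :
    ∃ C : ℝ, 0 ≤ C ∧ ∀ n i j, |(A ^ n) i j| ≤ C * q ^ n := by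
  have hq0 : 0 < q := ENNReal.ofReal_pos.1 (bot_le.trans_lt hq)
  have hev := (spectrum.pow_nnnorm_pow_one_div_tendsto_nhds_spectralRadius
    (A.map (fun a : ℝ => (a : ℂ)))).eventually (gt_mem_nhds hq)
  obtain ⟨n₀, hn₀⟩ := eventually_atTop.1 hev
  have hmap : ∀ n, (A.map (fun a : ℝ => (a : ℂ))) ^ n = (A ^ n).map (fun a : ℝ => (a : ℂ)) :=
    fun n => (Matrix.map_pow A Complex.ofRealHom n).symm
  have hentry : ∀ n i j, |(A ^ n) i j| ≤ ‖(A.map (fun a : ℝ => (a : ℂ))) ^ n‖ := by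
    intro n i j
    rw [hmap, Matrix.linfty_opNorm_def]
    have h1 : ‖((A ^ n).map (fun a : ℝ => (a : ℂ))) i j‖₊ ≤
        ∑ j', ‖((A ^ n).map (fun a : ℝ => (a : ℂ))) i j'‖₊ :=
      Finset.single_le_sum (f := fun j' => ‖((A ^ n).map (fun a : ℝ => (a : ℂ))) i j'‖₊)
        (fun _ _ => bot_le) (Finset.mem_univ j)
    have h2 := h1.trans (Finset.le_sup (f := fun i' =>
      ∑ j', ‖((A ^ n).map (fun a : ℝ => (a : ℂ))) i' j'‖₊) (Finset.mem_univ i))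
    have h3 : |(A ^ n) i j| = ((‖((A ^ n).map (fun a : ℝ => (a : ℂ))) i j‖₊ : NNReal) : ℝ) := by
      simp
    rw [h3]; exact_mod_cast h2
  have hlarge : ∀ n, n₀ + 1 ≤ n → ∀ i j, |(A ^ n) i j| ≤ q ^ n := by
    intro n hn i j
    refine (hentry n i j).trans ?_
    have h1 := (hn₀ n (by omega)).le
    have hn0 : (0 : ℝ) < n := by exact_mod_cast (by omega : 0 < n)
    have h2 := ENNReal.rpow_le_rpow h1 hn0.le
    rw [← ENNReal.rpow_mul, one_div, inv_mul_cancel₀ hn0.ne', ENNReal.rpow_one,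
      ENNReal.rpow_natCast, ← ENNReal.ofReal_pow hq0.le] at h2
    have h3 := ENNReal.toReal_mono ENNReal.ofReal_ne_top h2
    rw [ENNReal.toReal_ofReal (by positivity)] at h3
    simpa using h3
  -- Gelfand's formula gives constant `1` from `n₀ + 1` on; the sum absorbs the finitely many
  -- earlier powers, normalised by `q ^ n`.
  refine ⟨1 + ∑ n ∈ Finset.range (n₀ + 1), ∑ i, ∑ j, |(A ^ n) i j| / q ^ n, ?_, ?_⟩
  · positivity
  intro n i j
  by_cases hn : n₀ + 1 ≤ n
  · refine (hlarge n hn i j).trans (le_mul_of_one_le_left (by positivity) ?_)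
    have : 0 ≤ ∑ n ∈ Finset.range (n₀ + 1), ∑ i, ∑ j, |(A ^ n) i j| / q ^ n := by positivity
    linarith
  · have h1 : |(A ^ n) i j| / q ^ n ≤ ∑ j, |(A ^ n) i j| / q ^ n :=
      Finset.single_le_sum (f := fun j => |(A ^ n) i j| / q ^ n)
        (fun _ _ => by positivity) (Finset.mem_univ j)
    have h2 : ∑ j, |(A ^ n) i j| / q ^ n ≤ ∑ i, ∑ j, |(A ^ n) i j| / q ^ n :=
      Finset.single_le_sum (f := fun i => ∑ j, |(A ^ n) i j| / q ^ n)
        (fun _ _ => by positivity) (Finset.mem_univ i)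
    have h3 : ∑ i, ∑ j, |(A ^ n) i j| / q ^ n ≤
        ∑ n ∈ Finset.range (n₀ + 1), ∑ i, ∑ j, |(A ^ n) i j| / q ^ n :=
      Finset.single_le_sum (f := fun n => ∑ i, ∑ j, |(A ^ n) i j| / q ^ n)
        (fun _ _ => by positivity) (Finset.mem_range.2 (by omega))
    rw [← div_le_iff₀ (by positivity)]
    linarith

end SpectralRadius

/-! ### Quadratic forms and traces. -/

section QuadraticForms

theorem dotProduct_conj_mulVec {k l : ℕ} (A : Matrix (Fin k) (Fin l) ℝ)
    (X : Matrix (Fin l) (Fin l) ℝ) (a b : Fin k → ℝ) :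
    a ⬝ᵥ (A * X * Aᵀ) *ᵥ b = (a ᵥ* A) ⬝ᵥ X *ᵥ (b ᵥ* A) := by
  rw [← Matrix.mulVec_mulVec, ← Matrix.mulVec_mulVec, Matrix.dotProduct_mulVec,
    Matrix.mulVec_transpose]

/-- A positive semidefinite matrix is a sum of rank-one terms `v vᵀ`, and Cauchy–Schwarz applies to
each. -/
theorem dotProduct_mulVec_le_trace {k : ℕ} {X : Matrix (Fin k) (Fin k) ℝ} (hX : X.PosSemidef)
    (a : Fin k → ℝ) : a ⬝ᵥ X *ᵥ a ≤ X.trace * (a ⬝ᵥ a) := by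
  obtain ⟨m, v, rfl⟩ := Matrix.posSemidef_iff_eq_sum_vecMulVec.1 hX
  rw [Matrix.sum_mulVec, Matrix.trace_sum, dotProduct_sum, Finset.sum_mul]
  refine Finset.sum_le_sum fun i _ => ?_
  have h := Finset.sum_mul_sq_le_sq_mul_sq Finset.univ (v i) a
  rw [Matrix.vecMulVec_mulVec, Matrix.trace_vecMulVec]
  simp only [star_trivial, dotProduct_smul, MulOpposite.smul_eq_mul_unop, MulOpposite.unop_op]
  calc (a ⬝ᵥ v i) * (v i ⬝ᵥ a) = (∑ j, v i j * a j) ^ 2 := by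
        rw [dotProduct_comm a, sq]; rfl
    _ ≤ _ := h
    _ = _ := by simp [dotProduct, sq]

theorem trace_conj_le {k : ℕ} {A : Matrix (Fin k) (Fin k) ℝ} {β : ℝ}
    (hA : ∀ i j, |A i j| ≤ β) (X : Matrix (Fin k) (Fin k) ℝ) :
    (A * X * Aᵀ).trace ≤ (k * ∑ i, ∑ j, |X i j|) * β ^ 2 := by
  have h : ∀ i, (A * X * Aᵀ) i i ≤ (∑ i, ∑ j, |X i j|) * β ^ 2 := by
    intro i
    simp only [Matrix.mul_apply, Matrix.transpose_apply, Finset.sum_mul]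
    rw [Finset.sum_comm]
    refine Finset.sum_le_sum fun a _ => Finset.sum_le_sum fun b _ => ?_
    calc A i a * X a b * A i b ≤ |A i a * X a b * A i b| := le_abs_self _
      _ = |X a b| * (|A i a| * |A i b|) := by rw [abs_mul, abs_mul]; ring
      _ ≤ |X a b| * (β * β) := by
        have hβ : 0 ≤ β := (abs_nonneg _).trans (hA i a)
        gcongr
        exacts [hA i a, hA i b]
      _ = _ := by ring
  refine (Finset.sum_le_sum fun i _ => h i).trans ?_
  simp [mul_assoc]

end QuadraticForms

/-! ### Steady-state filter and open-loop covariance. -/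

namespace SensorModel

variable (s : SensorModel)

/-- Steady-state innovation covariance. -/
noncomputable def innov : Matrix (Fin s.r) (Fin s.r) ℝ := innovationCov s.A s.W s.P s.C s.V

/-- Error covariance `k` steps after the last reception. -/
noncomputable def openCov : ℕ → Matrix (Fin s.l) (Fin s.l) ℝ
  | 0 => s.P
  | k + 1 => priorCov s.A s.W (openCov k)

theorem _root_.RemoteEst.conj_posSemidef {k l : ℕ} {X : Matrix (Fin l) (Fin l) ℝ}
    (hX : X.PosSemidef) (A : Matrix (Fin k) (Fin l) ℝ) : (A * X * Aᵀ).PosSemidef := by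
  simpa using hX.mul_mul_conjTranspose_same A

theorem openCov_posSemidef (k : ℕ) : (s.openCov k).PosSemidef := by
  induction k with
  | zero => exact s.P_posSemidef
  | succ k ih => exact (conj_posSemidef ih _).add s.W_posSemidef

theorem innov_posSemidef : s.innov.PosSemidef :=
  (conj_posSemidef (s.openCov_posSemidef 1) _).add s.V_posSemidef

theorem innov_posDef : s.innov.PosDef :=
  s.innov_posSemidef.posDef_iff_det_ne_zero.2 s.innovation_invertible.ne_zero

theorem gain_mul_innov : s.gain * s.innov = priorCov s.A s.W s.P * s.Cᵀ :=
  Matrix.nonsing_inv_mul_cancel_right _ _ s.innovation_invertible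

theorem transpose_eq_of_posSemidef {k : ℕ} {X : Matrix (Fin k) (Fin k) ℝ} (hX : X.PosSemidef) :
    Xᵀ = X := by
  simpa using hX.isHermitian.eq

/-- The fixed-point equation gives `P⁻ - P = K C P⁻`, and transposing `K S = P⁻ Cᵀ` turns `C P⁻`
into `S Kᵀ`. -/
theorem prior_sub_post : priorCov s.A s.W s.P - s.P = s.gain * s.innov * s.gainᵀ := by
  have h1 : s.innov * s.gainᵀ = s.C * priorCov s.A s.W s.P := by
    have h := congrArg Matrix.transpose s.gain_mul_innov
    rwa [Matrix.transpose_mul, Matrix.transpose_mul, Matrix.transpose_transpose,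
      transpose_eq_of_posSemidef s.innov_posSemidef,
      transpose_eq_of_posSemidef (X := priorCov s.A s.W s.P) (s.openCov_posSemidef 1)] at h
  rw [Matrix.mul_assoc, h1]
  nth_rw 2 [s.steady_state]
  rw [Matrix.sub_mul, Matrix.one_mul, sub_sub_cancel, Matrix.mul_assoc]
  rfl

/-- The Joseph form of the steady-state covariance equation. -/
theorem joseph :
    (1 - s.gain * s.C) * priorCov s.A s.W s.P * (1 - s.gain * s.C)ᵀ +
      s.gain * s.V * s.gainᵀ = s.P := by
  have h1 : (1 - s.gain * s.C) * priorCov s.A s.W s.P = s.P := s.steady_state.symm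
  -- `(1 - K C) P⁻ Cᵀ = K S - K (C P⁻ Cᵀ)`, and `S - C P⁻ Cᵀ = V`. Thus the term `P Cᵀ Kᵀ` from the
  -- right factor cancels the measurement-noise term.
  have h2 : s.P * s.Cᵀ = s.gain * s.V := by
    rw [← h1, Matrix.mul_assoc, ← s.gain_mul_innov, Matrix.sub_mul, Matrix.one_mul]
    have h3 : s.innov = s.C * (priorCov s.A s.W s.P * s.Cᵀ) + s.V := by
      rw [← Matrix.mul_assoc]; rfl
    nth_rw 1 [h3]
    rw [← s.gain_mul_innov, Matrix.mul_add]
    simp only [Matrix.mul_assoc]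
    abel
  rw [h1, Matrix.transpose_sub, Matrix.mul_sub, Matrix.transpose_mul, ← Matrix.mul_assoc, h2]
  simp

/-- In successive differences `W` cancels, so they evolve by `X ↦ A X Aᵀ`, starting from `P⁻ - P = K
S Kᵀ`. -/
theorem openCov_eq_sum (k : ℕ) :
    s.openCov k = s.P + ∑ i ∈ Finset.range k,
      s.A ^ i * (s.gain * s.innov * s.gainᵀ) * (s.A ^ i)ᵀ := by
  have hstep : ∀ k, s.openCov (k + 1) - s.openCov k =
      s.A ^ k * (s.gain * s.innov * s.gainᵀ) * (s.A ^ k)ᵀ := by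
    intro k
    induction k with
    | zero => simpa [openCov] using s.prior_sub_post
    | succ k ih =>
      have h : s.openCov (k + 1 + 1) - s.openCov (k + 1) =
          s.A * (s.openCov (k + 1) - s.openCov k) * s.Aᵀ := by
        rw [Matrix.mul_sub, Matrix.sub_mul]
        simp only [openCov, priorCov, add_sub_add_right_eq_sub]
      rw [h, ih, pow_succ', Matrix.transpose_mul]
      simp only [Matrix.mul_assoc]
  induction k with
  | zero => simp [openCov]
  | succ k ih => rw [Finset.sum_range_succ, ← add_assoc, ← ih, ← hstep]; abel

/-- The open-loop error covariance grows at most like the powers of `A`. -/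
theorem exists_trace_openCov_le {q : ℝ} (hq : specRad s.A < ENNReal.ofReal q) :
    ∃ C : ℝ, 0 ≤ C ∧ ∀ k,
      (s.openCov k).trace ≤ C * (1 + ∑ i ∈ Finset.range k, (q ^ 2) ^ i) := by
  obtain ⟨C, hC, hA⟩ := exists_abs_pow_apply_le hq
  set X := s.gain * s.innov * s.gainᵀ with hX
  set D : ℝ := (s.l * ∑ i, ∑ j, |X i j|) * C ^ 2 with hD
  have hP := s.P_posSemidef.trace_nonneg
  have hD0 : 0 ≤ D := by positivity
  refine ⟨s.P.trace + D, by positivity, fun k => ?_⟩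
  rw [s.openCov_eq_sum, Matrix.trace_add, Matrix.trace_sum]
  have h1 : ∑ i ∈ Finset.range k, (s.A ^ i * X * (s.A ^ i)ᵀ).trace ≤
      D * ∑ i ∈ Finset.range k, (q ^ 2) ^ i := by
    rw [Finset.mul_sum]
    refine Finset.sum_le_sum fun i _ => (trace_conj_le (hA i) X).trans_eq ?_
    rw [hD]; ring
  have h2 : 0 ≤ ∑ i ∈ Finset.range k, (q ^ 2) ^ i := by positivity
  nlinarith [mul_nonneg hP h2]

/-- The open-loop error covariance grows at least like the powers of an unstable eigenvalue. -/
theorem exists_le_trace_openCov {z : ℂ} (hz : 1 ≤ ‖z‖) {v : Fin s.l → ℂ} (hv : v ≠ 0)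
    (hzv : v ᵥ* s.A.map (fun a : ℝ => (a : ℂ)) = z • v) :
    ∃ d : ℝ, 0 < d ∧ ∀ k,
      d * ∑ i ∈ Finset.range k, (‖z‖ ^ 2) ^ i ≤ (s.openCov k).trace := by
  -- A real matrix acts separately on the real and imaginary parts of `v`.
  set a : Fin s.l → ℝ := fun i => (v i).re with ha
  set b : Fin s.l → ℝ := fun i => (v i).im with hb
  have hre : ∀ {m : ℕ} (B : Matrix (Fin s.l) (Fin m) ℝ) (j : Fin m),
      (v ᵥ* B.map (fun a : ℝ => (a : ℂ))) j = ⟨(a ᵥ* B) j, (b ᵥ* B) j⟩ := by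
    intro m B j
    apply Complex.ext <;> simp [Matrix.vecMul, dotProduct, ha, hb]
  have hA : a ᵥ* s.A = z.re • a - z.im • b := by
    ext j
    have h := congrFun hzv j
    rw [hre] at h
    simpa [ha, hb] using congrArg Complex.re h
  have hB : b ᵥ* s.A = z.re • b + z.im • a := by
    ext j
    have h := congrFun hzv j
    rw [hre] at h
    simpa [ha, hb] using congrArg Complex.im h
  -- On the pair `(a, b)` the matrix acts as a rotation scaled by `‖z‖`, so the sum of the two
  -- quadratic forms is multiplied by `‖z‖ ^ 2`.
  have hstep : ∀ X : Matrix (Fin s.l) (Fin s.l) ℝ,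
      a ⬝ᵥ (s.A * X * s.Aᵀ) *ᵥ a + b ⬝ᵥ (s.A * X * s.Aᵀ) *ᵥ b =
        ‖z‖ ^ 2 * (a ⬝ᵥ X *ᵥ a + b ⬝ᵥ X *ᵥ b) := by
    intro X
    rw [dotProduct_conj_mulVec, dotProduct_conj_mulVec, hA, hB, Complex.sq_norm,
      Complex.normSq_apply]
    simp only [Matrix.mulVec_sub, Matrix.mulVec_add, Matrix.mulVec_smul, dotProduct_sub,
      dotProduct_add, sub_dotProduct, add_dotProduct, smul_dotProduct, dotProduct_smul,
      smul_eq_mul]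
    ring
  set X := s.gain * s.innov * s.gainᵀ with hX
  set d := a ⬝ᵥ X *ᵥ a + b ⬝ᵥ X *ᵥ b with hd
  have hpow : ∀ i, a ⬝ᵥ (s.A ^ i * X * (s.A ^ i)ᵀ) *ᵥ a +
      b ⬝ᵥ (s.A ^ i * X * (s.A ^ i)ᵀ) *ᵥ b = d * (‖z‖ ^ 2) ^ i := by
    intro i
    induction i with
    | zero => simp [hd]
    | succ i ih =>
      have h : s.A ^ (i + 1) * X * (s.A ^ (i + 1))ᵀ =
          s.A * (s.A ^ i * X * (s.A ^ i)ᵀ) * s.Aᵀ := by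
        rw [pow_succ', Matrix.transpose_mul]; simp only [Matrix.mul_assoc]
      rw [h, hstep, ih]; ring
  -- As `S` is positive definite, `d` can vanish only if `v K = 0`; then `z` is an eigenvalue of the
  -- stable matrix `(1 - K C) A`.
  have hdpos : 0 < d := by
    have hS := s.innov_posDef
    rw [hd, hX, dotProduct_conj_mulVec, dotProduct_conj_mulVec]
    by_cases hKa : a ᵥ* s.gain = 0
    · by_cases hKb : b ᵥ* s.gain = 0
      · exfalso
        have hvK : v ᵥ* s.gain.map (fun a : ℝ => (a : ℂ)) = 0 := by
          ext j
          rw [hre, hKa, hKb]; rfl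
        have hm : ((1 - s.gain * s.C) * s.A).map (fun a : ℝ => (a : ℂ)) =
            (1 - s.gain.map (fun a : ℝ => (a : ℂ)) * s.C.map (fun a : ℝ => (a : ℂ))) *
              s.A.map (fun a : ℝ => (a : ℂ)) := by
          change ((1 - s.gain * s.C) * s.A).map Complex.ofRealHom =
            (1 - s.gain.map Complex.ofRealHom * s.C.map Complex.ofRealHom) *
              s.A.map Complex.ofRealHom
          rw [Matrix.map_mul, Matrix.map_sub _ (map_sub _), Matrix.map_mul, Matrix.map_one]
            <;> simp
        have hspec : v ᵥ* ((1 - s.gain * s.C) * s.A).map (fun a : ℝ => (a : ℂ)) = z • v := by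
          rw [hm, ← Matrix.vecMul_vecMul, Matrix.vecMul_sub, ← Matrix.vecMul_vecMul, hvK]
          simpa using hzv
        have h := (le_specRad_of_vecMul hv hspec).trans_lt s.filter_stable
        have h' : ‖z‖₊ < 1 := by exact_mod_cast h
        exact absurd hz (not_le.2 (by exact_mod_cast h'))
      · have h1 := hS.posSemidef.dotProduct_mulVec_nonneg (a ᵥ* s.gain)
        have h2 := hS.dotProduct_mulVec_pos hKb
        simp only [star_trivial] at h1 h2
        linarith
    · have h1 := hS.posSemidef.dotProduct_mulVec_nonneg (b ᵥ* s.gain)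
      have h2 := hS.dotProduct_mulVec_pos hKa
      simp only [star_trivial] at h1 h2
      linarith
  set e := a ⬝ᵥ a + b ⬝ᵥ b with he
  have ha0 : 0 ≤ a ⬝ᵥ a := by simpa using dotProduct_star_self_nonneg a
  have hb0 : 0 ≤ b ⬝ᵥ b := by simpa using dotProduct_star_self_nonneg b
  have hle : ∀ k, d * ∑ i ∈ Finset.range k, (‖z‖ ^ 2) ^ i ≤ (s.openCov k).trace * e := by
    intro k
    have h1 := dotProduct_mulVec_le_trace (s.openCov_posSemidef k) a
    have h2 := dotProduct_mulVec_le_trace (s.openCov_posSemidef k) b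
    have h3 : a ⬝ᵥ (s.openCov k) *ᵥ a + b ⬝ᵥ (s.openCov k) *ᵥ b =
        (a ⬝ᵥ s.P *ᵥ a + b ⬝ᵥ s.P *ᵥ b) + d * ∑ i ∈ Finset.range k, (‖z‖ ^ 2) ^ i := by
      rw [s.openCov_eq_sum, Matrix.add_mulVec, Matrix.add_mulVec, Matrix.sum_mulVec,
        Matrix.sum_mulVec, dotProduct_add, dotProduct_add, dotProduct_sum, dotProduct_sum,
        Finset.mul_sum, ← Finset.sum_congr rfl fun i _ => hpow i, Finset.sum_add_distrib]
      ring
    have h4 := s.P_posSemidef.dotProduct_mulVec_nonneg a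
    have h5 := s.P_posSemidef.dotProduct_mulVec_nonneg b
    simp only [star_trivial] at h4 h5
    rw [he, mul_add]
    linarith
  -- The bound at `k = 1` reads `d ≤ tr · e`, which excludes `e = 0`.
  have hepos : 0 < e := by
    have h := hle 1
    simp only [Finset.range_one, Finset.sum_singleton, pow_zero, mul_one] at h
    rcases (add_nonneg ha0 hb0).eq_or_lt with h0 | h0
    · rw [he, ← h0, mul_zero] at h; linarith
    · exact h0
  refine ⟨d / e, by positivity, fun k => ?_⟩
  rw [div_mul_eq_mul_div, div_le_iff₀ hepos]
  exact hle k

end SensorModel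

/-! ### Second moments of random vectors. -/

/-- `X` is a square-integrable random vector with second-moment matrix `P`. -/
structure HasSecondMoment {Ω : Type*} [MeasurableSpace Ω] (μ : Measure Ω) {k : ℕ}
    (X : Ω → Fin k → ℝ) (P : Matrix (Fin k) (Fin k) ℝ) : Prop where
  memLp : ∀ i, MemLp (fun ω => X ω i) 2 μ
  integral_mul : ∀ i j, ∫ ω, X ω i * X ω j ∂μ = P i j

namespace HasSecondMoment

variable {Ω : Type*} [MeasurableSpace Ω] {μ : Measure Ω} {k m : ℕ} {X Y : Ω → Fin k → ℝ}
  {P Q : Matrix (Fin k) (Fin k) ℝ}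

theorem neg (hX : HasSecondMoment μ X P) : HasSecondMoment μ (fun ω => -X ω) P where
  memLp i := (hX.memLp i).neg
  integral_mul i j := by simpa using hX.integral_mul i j

theorem mulVec (hX : HasSecondMoment μ X P) (B : Matrix (Fin m) (Fin k) ℝ) :
    HasSecondMoment μ (fun ω => B *ᵥ X ω) (B * P * Bᵀ) where
  memLp i := by
    simp only [Matrix.mulVec, dotProduct]
    exact memLp_finsetSum _ fun j _ => (hX.memLp j).const_mul _
  integral_mul i j := by
    have h : ∀ ω, (B *ᵥ X ω) i * (B *ᵥ X ω) j =
        ∑ b, ∑ a, B i a * B j b * (X ω a * X ω b) := by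
      intro ω
      simp only [Matrix.mulVec, dotProduct, Finset.sum_mul_sum]
      rw [Finset.sum_comm]
      exact Finset.sum_congr rfl fun b _ => Finset.sum_congr rfl fun a _ => by ring
    have hint : ∀ a b, Integrable (fun ω => B i a * B j b * (X ω a * X ω b)) μ :=
      fun a b => ((hX.memLp a).integrable_mul (hX.memLp b)).const_mul _
    simp_rw [h]
    rw [integral_finsetSum _ fun b _ => integrable_finsetSum _ fun a _ => hint a b]
    simp_rw [Matrix.mul_apply, Matrix.transpose_apply, Finset.sum_mul]
    refine Finset.sum_congr rfl fun b _ => ?_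
    rw [integral_finsetSum _ fun a _ => hint a b]
    refine Finset.sum_congr rfl fun a _ => ?_
    rw [integral_const_mul, hX.integral_mul]
    ring

/-- One centred summand suffices to kill the cross terms. This matters because the initial
estimation error is not assumed to have mean zero. -/
theorem add [IsProbabilityMeasure μ] (hX : HasSecondMoment μ X P) (hY : HasSecondMoment μ Y Q)
    (hXY : IndepFun X Y μ) (hY0 : ∀ i, ∫ ω, Y ω i ∂μ = 0) :
    HasSecondMoment μ (fun ω => X ω + Y ω) (P + Q) where
  memLp i := (hX.memLp i).add (hY.memLp i)
  integral_mul i j := by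
    have hcross : ∀ i j, ∫ ω, X ω i * Y ω j ∂μ = 0 := by
      intro i j
      have h : IndepFun (fun ω => X ω i) (fun ω => Y ω j) μ :=
        hXY.comp (measurable_pi_apply i) (measurable_pi_apply j)
      rw [h.integral_fun_mul_eq_mul_integral (hX.memLp i).aestronglyMeasurable
        (hY.memLp j).aestronglyMeasurable, hY0, mul_zero]
    have h : ∀ ω, (X ω + Y ω) i * (X ω + Y ω) j =
        (X ω i * X ω j + Y ω i * Y ω j) + (X ω i * Y ω j + X ω j * Y ω i) := by
      intro ω; simp only [Pi.add_apply]; ring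
    have hi1 : ∀ i j, Integrable (fun ω => X ω i * X ω j) μ :=
      fun i j => (hX.memLp i).integrable_mul (hX.memLp j)
    have hi2 : ∀ i j, Integrable (fun ω => Y ω i * Y ω j) μ :=
      fun i j => (hY.memLp i).integrable_mul (hY.memLp j)
    have hi3 : ∀ i j, Integrable (fun ω => X ω i * Y ω j) μ :=
      fun i j => (hX.memLp i).integrable_mul (hY.memLp j)
    refine (integral_congr_ae (Eventually.of_forall h)).trans ?_
    refine (integral_add ((hi1 i j).add (hi2 i j)) ((hi3 i j).add (hi3 j i))).trans ?_
    refine (congrArg₂ (· + ·) (integral_add (hi1 i j) (hi2 i j))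
      (integral_add (hi3 i j) (hi3 j i))).trans ?_
    simp [hcross, hX.integral_mul, hY.integral_mul]

theorem lintegral_sum_sq (hX : HasSecondMoment μ X P) :
    ∫⁻ ω, ENNReal.ofReal (∑ i, X ω i ^ 2) ∂μ = ENNReal.ofReal P.trace := by
  have hint : ∀ i, Integrable (fun ω => X ω i ^ 2) μ := fun i => (hX.memLp i).integrable_sq
  rw [← ofReal_integral_eq_lintegral_ofReal (integrable_finsetSum _ fun i _ => hint i)
    (Eventually.of_forall fun ω => by positivity), integral_finsetSum _ fun i _ => hint i]
  refine congrArg _ (Finset.sum_congr rfl fun i _ => ?_)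
  simpa [sq] using hX.integral_mul i i

end HasSecondMoment

section Gaussian

variable {Ω : Type*} [MeasurableSpace Ω] {μ : Measure Ω} {k : ℕ} {w : Ω → Fin k → ℝ}
  {W : Matrix (Fin k) (Fin k) ℝ}

theorem IsCenteredGaussian.hasSecondMoment (hw : IsCenteredGaussian μ w W) (hm : Measurable w) :
    HasSecondMoment μ w W where
  memLp i := by
    have := hw.1
    have h := IsGaussian.memLp_dual (μ.map w) (ContinuousLinearMap.proj (R := ℝ) i) 2 (by simp)
    exact h.comp_of_map hm.aemeasurable
  integral_mul := hw.2.2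

end Gaussian

/-! ### Elementary properties of the ages. -/

section Age

variable {N M K : ℕ} (c : ChannelModel M K) (π : Policy N M K)

theorem one_le_aoi (h : ℕ → Fin K) (t : ℕ) (n : Fin N) : 1 ≤ aoi c π h (t + 1) n := by
  cases t with
  | zero => simp [aoi]
  | succ t => rw [aoi]; dsimp only; split_ifs <;> omega

theorem aoi_le (h : ℕ → Fin K) (t : ℕ) (n : Fin N) : aoi c π h (t + 1) n ≤ t + 1 := by
  induction t with
  | zero => simp [aoi]
  | succ t ih => rw [aoi]; dsimp only; split_ifs <;> omega

theorem measurable_aoi (t : ℕ) : Measurable fun h : ℕ → Fin K => aoi c π h t := by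
  classical
  induction t with
  | zero => exact measurable_const
  | succ t ih =>
    cases t with
    | zero => exact measurable_const
    | succ t =>
      let F : (Fin N → ℕ) × Fin K × Fin K → Fin N → ℕ := fun p n =>
        if Arrives c π p.1 p.2.1 p.2.2 n then 1 else p.1 n + 1
      have hF : Measurable F := measurable_of_countable F
      have h : (fun h : ℕ → Fin K => aoi c π h (t + 1 + 1)) =
          F ∘ fun h => (aoi c π h (t + 1), h t, h (t + 1)) := by
        funext h n
        simp only [F, Function.comp, aoi]
      rw [h]
      exact hF.comp (ih.prodMk ((measurable_pi_apply _).prodMk (measurable_pi_apply _)))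

end Age

/-! ### Independent sources, estimation errors and the mean-square error as a function of the age.
-/

namespace Randomness

variable {N M K : ℕ} {sensor : Fin N → SensorModel} {c : ChannelModel M K}
  {Ω : Type*} [MeasurableSpace Ω] {μ : Measure Ω} (R : Randomness sensor c μ)

/-- The σ-algebra generated by one of the independent sources of randomness. -/
@[reducible] def sourceAlgebra : Source N → MeasurableSpace Ω
  | .init n => MeasurableSpace.comap (fun ω => (R.x₀ n ω, R.xs₀ n ω)) inferInstance
  | .process n t => MeasurableSpace.comap (R.w n t) inferInstance
  | .measurement n t => MeasurableSpace.comap (R.v n (t + 1)) inferInstance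
  | .channel => MeasurableSpace.comap (fun ω t => R.h t ω) inferInstance

theorem iIndep_sourceAlgebra : iIndep R.sourceAlgebra μ := by
  refine (congrArg (fun m : Source N → MeasurableSpace Ω => iIndep m μ) (funext fun s => ?_)).mpr
    R.indep
  cases s <;> rfl

theorem measurable_path : Measurable fun ω t => R.h t ω :=
  measurable_pi_lambda _ R.measurable_h

theorem sourceAlgebra_le (s : Source N) : R.sourceAlgebra s ≤ ‹MeasurableSpace Ω› := by
  cases s with
  | init n => exact ((R.measurable_x₀ n).prodMk (R.measurable_xs₀ n)).comap_le
  | process n t => exact (R.measurable_w n t).comap_le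
  | measurement n t => exact (R.measurable_v n (t + 1)).comap_le
  | channel => exact R.measurable_path.comap_le

/-- The σ-algebra generated by a set of sources. -/
@[reducible] def algebraOf (S : Set (Source N)) : MeasurableSpace Ω := ⨆ s ∈ S, R.sourceAlgebra s

theorem algebraOf_le (S : Set (Source N)) : R.algebraOf S ≤ ‹MeasurableSpace Ω› :=
  iSup₂_le fun s _ => R.sourceAlgebra_le s

theorem algebraOf_mono {S T : Set (Source N)} (h : S ⊆ T) : R.algebraOf S ≤ R.algebraOf T :=
  biSup_mono h

theorem indep_algebraOf {S T : Set (Source N)} (h : Disjoint S T) :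
    Indep (R.algebraOf S) (R.algebraOf T) μ :=
  indep_iSup_of_disjoint R.sourceAlgebra_le R.iIndep_sourceAlgebra h

theorem sourceAlgebra_le_algebraOf {S : Set (Source N)} {s : Source N} (hs : s ∈ S) :
    R.sourceAlgebra s ≤ R.algebraOf S :=
  le_iSup₂ (f := fun s (_ : s ∈ S) => R.sourceAlgebra s) s hs

/-- The sources on which the local estimation error of sensor `n` in slot `t` depends. -/
def past (n : Fin N) (t : ℕ) : Set (Source N) :=
  {s | s = .init n ∨ ∃ u < t, s = .process n u ∨ s = .measurement n u}

theorem past_mono (n : Fin N) {t u : ℕ} (h : t ≤ u) : past n t ⊆ past n u := by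
  rintro s (hs | ⟨i, hi, hs⟩)
  · exact .inl hs
  · exact .inr ⟨i, hi.trans_le h, hs⟩

theorem measurable_w_algebraOf {S : Set (Source N)} {n : Fin N} {t : ℕ}
    (h : Source.process n t ∈ S) : Measurable[R.algebraOf S] (R.w n t) :=
  (comap_measurable (R.w n t)).mono (R.sourceAlgebra_le_algebraOf h) le_rfl

theorem measurable_v_algebraOf {S : Set (Source N)} {n : Fin N} {t : ℕ}
    (h : Source.measurement n t ∈ S) : Measurable[R.algebraOf S] (R.v n (t + 1)) :=
  (comap_measurable (R.v n (t + 1))).mono (R.sourceAlgebra_le_algebraOf h) le_rfl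

theorem indepFun_of_disjoint {S T : Set (Source N)} (h : Disjoint S T) {k l : ℕ}
    {X : Ω → Fin k → ℝ} {Y : Ω → Fin l → ℝ} (hX : Measurable[R.algebraOf S] X)
    (hY : Measurable[R.algebraOf T] Y) : IndepFun X Y μ :=
  indep_of_indep_of_le_left (indep_of_indep_of_le_right (R.indep_algebraOf h) hY.comap_le)
    hX.comap_le

/-- Local estimation error. -/
noncomputable def localErr (n : Fin N) (t : ℕ) (ω : Ω) : Fin (sensor n).l → ℝ :=
  R.xs n t ω - R.x n t ω

/-- The process state drops out: prediction by `A` with noise `-w` is followed by correction by `1 -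
K C` with noise `K v`. -/
theorem localErr_succ (n : Fin N) (t : ℕ) (ω : Ω) :
    R.localErr n (t + 1) ω =
      (1 - (sensor n).gain * (sensor n).C) *ᵥ ((sensor n).A *ᵥ R.localErr n t ω + -R.w n t ω) +
        (sensor n).gain *ᵥ R.v n (t + 1) ω := by
  simp only [localErr, xs, y, x, Matrix.mulVec_add, Matrix.mulVec_sub, Matrix.sub_mulVec,
    Matrix.one_mulVec, ← Matrix.mulVec_mulVec, Matrix.mulVec_neg]
  abel

/-- Estimation error after `k` steps of open-loop prediction from the local estimate of
slot `s`. -/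
noncomputable def openErr (n : Fin N) (s : ℕ) : ℕ → Ω → Fin (sensor n).l → ℝ
  | 0 => R.localErr n s
  | k + 1 => fun ω => (sensor n).A *ᵥ openErr n s k ω + -R.w n (s + k) ω

theorem _root_.RemoteEst.measurable_mulVec {k l : ℕ} {α : Type*} [MeasurableSpace α]
    (B : Matrix (Fin k) (Fin l) ℝ) {X : α → Fin l → ℝ} (hX : Measurable X) :
    Measurable fun a => B *ᵥ X a :=
  (Continuous.matrix_mulVec continuous_const continuous_id).measurable.comp hX

theorem measurable_localErr (n : Fin N) (t : ℕ) :
    Measurable[R.algebraOf (past n t)] (R.localErr n t) := by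
  induction t with
  | zero =>
    have h := (comap_measurable fun ω => (R.x₀ n ω, R.xs₀ n ω)).mono
      (R.sourceAlgebra_le_algebraOf (S := past n 0) (s := .init n) (.inl rfl)) le_rfl
    exact (measurable_snd.sub measurable_fst).comp h
  | succ t ih =>
    have hw := R.measurable_w_algebraOf (S := past n (t + 1)) (n := n) (t := t)
      (.inr ⟨t, t.lt_succ_self, .inl rfl⟩)
    have hv := R.measurable_v_algebraOf (S := past n (t + 1)) (n := n) (t := t)
      (.inr ⟨t, t.lt_succ_self, .inr rfl⟩)
    have ih' := ih.mono (R.algebraOf_mono (past_mono n t.le_succ)) le_rfl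
    rw [funext (R.localErr_succ n t)]
    let mS := R.algebraOf (past n (t + 1))
    exact (measurable_mulVec _ ((measurable_mulVec _ ih').add hw.neg)).add (measurable_mulVec _ hv)

theorem measurable_openErr (n : Fin N) (s k : ℕ) :
    Measurable[R.algebraOf (past n (s + k))] (R.openErr n s k) := by
  induction k with
  | zero => exact R.measurable_localErr n s
  | succ k ih =>
    have hw := R.measurable_w_algebraOf (S := past n (s + (k + 1))) (n := n) (t := s + k)
      (.inr ⟨s + k, by omega, .inl rfl⟩)
    have ih' := ih.mono (R.algebraOf_mono (past_mono n (by omega : s + k ≤ s + (k + 1)))) le_rfl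
    let mS := R.algebraOf (past n (s + (k + 1)))
    exact (measurable_mulVec _ ih').add hw.neg

theorem process_notMem_past (n : Fin N) (t : ℕ) :
    Disjoint (past n t) {Source.process n t} := by
  rw [Set.disjoint_singleton_right]
  rintro (h | ⟨u, hu, h | h⟩) <;> simp at h
  omega

theorem measurement_notMem_past (n : Fin N) (t : ℕ) :
    Disjoint (past n t ∪ {Source.process n t}) {Source.measurement n t} := by
  rw [Set.disjoint_singleton_right]
  rintro ((h | ⟨u, hu, h | h⟩) | h) <;> simp at h
  omega

theorem x_succ (n : Fin N) (t : ℕ) (ω : Ω) :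
    R.x n (t + 1) ω = (sensor n).A *ᵥ R.x n t ω + R.w n t ω := rfl

/-- The remote estimation error is the open-loop error since the last reception. -/
theorem xhat_sub_x (π : Policy N M K) (n : Fin N) (t : ℕ) (ω : Ω) :
    R.xhat π n (t + 1) ω - R.x n (t + 1) ω =
      R.openErr n (t + 1 - aoi c π (fun u => R.h u ω) (t + 1) n)
        (aoi c π (fun u => R.h u ω) (t + 1) n) ω := by
  induction t with
  | zero =>
    -- Slot `0` counts as a reception, so age `1` in slot `1` points back to the local estimate of
    -- slot `0`.
    have h1 : R.xhat π n (0 + 1) ω = (sensor n).A *ᵥ R.xs n 0 ω := if_pos trivial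
    rw [h1, x_succ]
    simp only [aoi, openErr, localErr, Matrix.mulVec_sub]
    abel
  | succ t ih =>
    have hle := aoi_le c π (fun u => R.h u ω) t n
    by_cases h : Received c π (fun u => R.h u ω) (t + 1) n
    · have h1 : R.xhat π n (t + 1 + 1) ω = (sensor n).A *ᵥ R.xs n (t + 1) ω := if_pos h
      have h2 : aoi c π (fun u => R.h u ω) (t + 1 + 1) n = 1 := if_pos h
      rw [h1, h2, Nat.add_sub_cancel]
      simp only [openErr, localErr, Matrix.mulVec_sub, add_zero, R.x_succ n (t + 1)]
      abel
    · have h1 : R.xhat π n (t + 1 + 1) ω = (sensor n).A *ᵥ R.xhat π n (t + 1) ω := if_neg h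
      have h2 : aoi c π (fun u => R.h u ω) (t + 1 + 1) n =
        aoi c π (fun u => R.h u ω) (t + 1) n + 1 := if_neg h
      rw [h1, h2, Nat.add_sub_add_right]
      simp only [openErr]
      rw [← ih, Nat.sub_add_cancel hle, x_succ, Matrix.mulVec_sub]
      abel

theorem integral_neg_w (n : Fin N) (t : ℕ) (i : Fin (sensor n).l) :
    ∫ ω, (-R.w n t ω) i ∂μ = 0 := by
  simp only [Pi.neg_apply]
  rw [integral_neg, (R.gaussian_w n t).2.1, neg_zero]

variable [IsProbabilityMeasure μ]

theorem integral_mulVec_v (n : Fin N) (t : ℕ) {k : ℕ}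
    (B : Matrix (Fin k) (Fin (sensor n).r) ℝ) (i : Fin k) :
    ∫ ω, (B *ᵥ R.v n t ω) i ∂μ = 0 := by
  have hm := (R.gaussian_v n t).hasSecondMoment (R.measurable_v n t)
  simp only [Matrix.mulVec, dotProduct]
  rw [integral_finsetSum _ fun j _ => ((hm.memLp j).integrable (by norm_num)).const_mul _]
  refine Finset.sum_eq_zero fun j _ => ?_
  rw [integral_const_mul, (R.gaussian_v n t).2.1, mul_zero]

/-- The noise `w n t` is not among the sources in `past n t`, so it is independent of `X`. -/
theorem hasSecondMoment_predict {n : Fin N} {t : ℕ} {X : Ω → Fin (sensor n).l → ℝ}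
    {P : Matrix (Fin (sensor n).l) (Fin (sensor n).l) ℝ} (hX : HasSecondMoment μ X P)
    (hXm : Measurable[R.algebraOf (past n t)] X) :
    HasSecondMoment μ (fun ω => (sensor n).A *ᵥ X ω + -R.w n t ω)
      (priorCov (sensor n).A (sensor n).W P) := by
  have hw := ((R.gaussian_w n t).hasSecondMoment (R.measurable_w n t)).neg
  refine (hX.mulVec _).add hw ?_ (R.integral_neg_w n t)
  refine R.indepFun_of_disjoint (process_notMem_past n t) ?_ ?_
  · let mS := R.algebraOf (past n t)
    exact measurable_mulVec _ hXm
  · have := R.measurable_w_algebraOf (S := {Source.process n t}) (n := n) (t := t) rfl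
    let mS := R.algebraOf {Source.process n t}
    exact this.neg

/-- Prediction and correction together map the second moment `P` to the Joseph form, which equals
`P`. -/
theorem hasSecondMoment_localErr (n : Fin N) (t : ℕ) :
    HasSecondMoment μ (R.localErr n t) (sensor n).P := by
  induction t with
  | zero => exact ⟨R.memLp_init n, R.cov_init n⟩
  | succ t ih =>
    have h1 := R.hasSecondMoment_predict ih (R.measurable_localErr n t)
    have hv := ((R.gaussian_v n (t + 1)).hasSecondMoment (R.measurable_v n (t + 1))).mulVec
      (sensor n).gain
    have h2 := (h1.mulVec (1 - (sensor n).gain * (sensor n).C)).add hv ?_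
      (R.integral_mulVec_v n (t + 1) _)
    · rw [(sensor n).joseph] at h2
      rwa [funext (R.localErr_succ n t)]
    · refine R.indepFun_of_disjoint (measurement_notMem_past n t) ?_ ?_
      · have hm := (R.measurable_localErr n t).mono
          (R.algebraOf_mono (Set.subset_union_left (t := {Source.process n t}))) le_rfl
        have hw := R.measurable_w_algebraOf (S := past n t ∪ {Source.process n t}) (n := n)
          (t := t) (.inr rfl)
        let mS := R.algebraOf (past n t ∪ {Source.process n t})
        exact measurable_mulVec _ ((measurable_mulVec _ hm).add hw.neg)
      · have := R.measurable_v_algebraOf (S := {Source.measurement n t}) (n := n) (t := t) rfl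
        let mS := R.algebraOf {Source.measurement n t}
        exact measurable_mulVec _ this

/-- The second moment does not depend on the starting slot `s`, so the age alone determines the
error covariance. -/
theorem hasSecondMoment_openErr (n : Fin N) (s k : ℕ) :
    HasSecondMoment μ (R.openErr n s k) ((sensor n).openCov k) := by
  induction k with
  | zero => exact R.hasSecondMoment_localErr n s
  | succ k ih => exact R.hasSecondMoment_predict ih (R.measurable_openErr n s k)

/-- The mean-square error is the expected trace of the open-loop covariance at the current age. -/
theorem mse_eq (π : Policy N M K) (n : Fin N) (t : ℕ) :
    R.mse π n (t + 1) = ∫⁻ ω, ENNReal.ofReal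
      ((sensor n).openCov (aoi c π (fun u => R.h u ω) (t + 1) n)).trace ∂μ := by
  classical
  set age : Ω → ℕ := fun ω => aoi c π (fun u => R.h u ω) (t + 1) n with hage
  have hm : Measurable[R.algebraOf {Source.channel}] age := by
    have h := (comap_measurable fun ω t => R.h t ω).mono
      (R.sourceAlgebra_le_algebraOf (S := {Source.channel}) (s := .channel) rfl) le_rfl
    exact ((measurable_pi_apply n).comp (measurable_aoi c π (t + 1))).comp h
  -- The age in slot `t + 1` is at most `t + 1`, so the random index takes finitely many values.
  have hsplit : ∀ F : ℕ → Ω → ℝ≥0∞, (∀ k, Measurable (F k)) →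
      ∫⁻ ω, F (age ω) ω ∂μ = ∑ k ∈ Finset.range (t + 2),
        ∫⁻ ω, (age ⁻¹' {k}).indicator 1 ω * F k ω ∂μ := by
    intro F hF
    rw [← lintegral_finsetSum' _ fun k _ => ?_]
    · refine lintegral_congr fun ω => ?_
      rw [Finset.sum_eq_single (age ω)]
      · simp
      · intro k _ hk
        rw [Set.indicator_of_notMem (by simpa using hk.symm), zero_mul]
      · intro h
        exact absurd (Finset.mem_range.2 (by
          have := aoi_le c π (fun u => R.h u ω) t n
          simp only [hage]; omega)) h
    · have hset : MeasurableSet (age ⁻¹' {k}) :=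
        R.algebraOf_le _ _ (hm (measurableSet_singleton k))
      exact ((measurable_one.indicator hset).mul (hF k)).aemeasurable
  -- The event `age = k` depends on the channel only and the open-loop error on the process sources
  -- only, so the expectation factors.
  have hind : ∀ k, ∫⁻ ω, (age ⁻¹' {k}).indicator 1 ω *
        ENNReal.ofReal (∑ i, R.openErr n (t + 1 - k) k ω i ^ 2) ∂μ =
      ∫⁻ ω, (age ⁻¹' {k}).indicator 1 ω *
        ENNReal.ofReal ((sensor n).openCov k).trace ∂μ := by
    intro k
    have hd : Disjoint {Source.channel} (past n (t + 1 - k + k)) := by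
      rw [Set.disjoint_singleton_left]
      rintro (h | ⟨u, hu, h | h⟩) <;> simp at h
    have hf : Measurable[R.algebraOf {Source.channel}]
        ((age ⁻¹' {k}).indicator (1 : Ω → ℝ≥0∞)) := by
      have hset := hm (measurableSet_singleton k)
      let mS := R.algebraOf {Source.channel}
      exact measurable_one.indicator hset
    have hg : Measurable[R.algebraOf (past n (t + 1 - k + k))]
        (fun ω => ENNReal.ofReal (∑ i, R.openErr n (t + 1 - k) k ω i ^ 2)) := by
      have h := R.measurable_openErr n (t + 1 - k) k
      let mS := R.algebraOf (past n (t + 1 - k + k))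
      exact (Finset.measurable_fun_sum _ fun i _ =>
        ((measurable_pi_apply i).comp h).pow_const 2).ennreal_ofReal
    rw [lintegral_mul_eq_lintegral_mul_lintegral_of_independent_measurableSpace
      (R.algebraOf_le _) (R.algebraOf_le _) (R.indep_algebraOf hd) hf hg,
      (R.hasSecondMoment_openErr n (t + 1 - k) k).lintegral_sum_sq, lintegral_mul_const]
    exact hf.mono (R.algebraOf_le _) le_rfl
  have hxe : R.mse π n (t + 1) = ∫⁻ ω, (fun k ω =>
      ENNReal.ofReal (∑ i, R.openErr n (t + 1 - k) k ω i ^ 2)) (age ω) ω ∂μ := by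
    refine lintegral_congr fun ω => ?_
    have h := R.xhat_sub_x π n t ω
    refine congrArg _ (Finset.sum_congr rfl fun i _ => ?_)
    rw [← Pi.sub_apply, h]
  rw [hxe, hsplit (fun k ω => ENNReal.ofReal (∑ i, R.openErr n (t + 1 - k) k ω i ^ 2)),
    Finset.sum_congr rfl fun k _ => hind k]
  · exact (hsplit (fun k _ => ENNReal.ofReal ((sensor n).openCov k).trace)
      fun k => measurable_const).symm
  · intro k
    have h := (R.measurable_openErr n (t + 1 - k) k).mono (R.algebraOf_le _) le_rfl
    exact (Finset.measurable_fun_sum _ fun i _ =>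
        ((measurable_pi_apply i).comp h).pow_const 2).ennreal_ofReal

end Randomness

/-! ### The all-off state and the spectral radius of `offPart`. -/

namespace ChannelModel

variable {N M K : ℕ} (c : ChannelModel M K)

/-- All channels are off in the vector state `j`. -/
def IsOff (j : Fin K) : Prop := ∀ m, c.state j m = false

/-- Uniqueness of the all-off state leaves `offPart` with at most one nonzero column. -/
theorem IsOff.eq {c : ChannelModel M K} {i j : Fin K} (hi : c.IsOff i) (hj : c.IsOff j) :
    i = j :=
  c.state_injective (funext fun m => (hi m).trans (hj m).symm)

theorem offPart_apply_of_isOff {j : Fin K} (hj : c.IsOff j) (i : Fin K) :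
    c.offPart i j = c.T i j := by
  simp [offPart, onPart, show ∀ m, c.state j m = false from hj]

theorem offPart_apply_of_not_isOff {j : Fin K} (hj : ¬ c.IsOff j) (i : Fin K) :
    c.offPart i j = 0 := by
  have hj' : ¬ ∀ m, c.state j m = false := hj
  simp only [offPart, onPart, Matrix.sub_apply, Matrix.of_apply, if_neg hj', sub_self]

theorem T_nonneg (i j : Fin K) : 0 ≤ c.T i j := c.irreducible.nonneg i j

theorem T_le_one (i j : Fin K) : c.T i j ≤ 1 :=
  (Finset.single_le_sum (f := fun j => c.T i j) (fun j _ => c.T_nonneg i j)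
    (Finset.mem_univ j)).trans_eq (c.row_sum i)

theorem pow_nonneg (k : ℕ) (i j : Fin K) : 0 ≤ (c.T ^ k) i j := by
  induction k generalizing i j with
  | zero => rw [pow_zero, Matrix.one_apply]; split_ifs <;> norm_num
  | succ k ih =>
    rw [pow_succ, Matrix.mul_apply]
    exact Finset.sum_nonneg fun l _ => mul_nonneg (ih i l) (c.T_nonneg l j)

theorem exists_pow_pos (i j : Fin K) : ∃ k, 0 < (c.T ^ k) i j := by
  obtain ⟨k, -, hk⟩ := (Matrix.isIrreducible_iff_exists_pow_pos c.T_nonneg).1 c.irreducible i j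
  exact ⟨k, hk⟩

theorem specRad_offPart_of_forall_not_isOff (h : ∀ j, ¬ c.IsOff j) : specRad c.offPart = 0 := by
  by_contra hne
  obtain ⟨z, v, hv, hzv, hz⟩ := exists_vecMul_of_specRad_ne_zero hne
  refine hv (funext fun j => ?_)
  have hj := congrFun hzv j
  have hz0 : z ≠ 0 := by rintro rfl; exact hne (by simpa using hz.symm)
  simp only [Matrix.vecMul, dotProduct, Matrix.map_apply,
    c.offPart_apply_of_not_isOff (h j), Complex.ofReal_zero, mul_zero, Finset.sum_const_zero,
    Pi.smul_apply, smul_eq_mul] at hj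
  simpa [hz0] using hj.symm

/-- Only column `o` is nonzero, so a left eigenvector for a nonzero eigenvalue is supported at `o`;
conversely the unit vector at `o` is a left eigenvector for `c.T o o`. -/
theorem specRad_offPart_of_isOff {o : Fin K} (ho : c.IsOff o) :
    specRad c.offPart = ENNReal.ofReal (c.T o o) := by
  have hcol : ∀ (v : Fin K → ℂ) (j : Fin K), j ≠ o →
      (v ᵥ* c.offPart.map (fun a : ℝ => (a : ℂ))) j = 0 := by
    intro v j hj
    have hj' : ¬ c.IsOff j := fun h => hj (h.eq ho)
    simp [Matrix.vecMul, dotProduct, c.offPart_apply_of_not_isOff hj']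
  have hnorm : ((‖((c.T o o : ℝ) : ℂ)‖₊ : NNReal) : ℝ≥0∞) = ENNReal.ofReal (c.T o o) := by
    rw [← enorm_eq_nnnorm, ← ofReal_norm, Complex.norm_real, Real.norm_of_nonneg (c.T_nonneg o o)]
  apply le_antisymm
  · by_cases hne : specRad c.offPart = 0
    · rw [hne]; exact bot_le
    obtain ⟨z, v, hv, hzv, hz⟩ := exists_vecMul_of_specRad_ne_zero hne
    have hz0 : z ≠ 0 := by rintro rfl; exact hne (by simpa using hz.symm)
    have hv0 : ∀ j, j ≠ o → v j = 0 := by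
      intro j hj
      have h := congrFun hzv j
      rw [hcol v j hj] at h
      simpa [hz0] using h.symm
    have hvo : v o ≠ 0 := by
      intro h
      refine hv (funext fun j => ?_)
      by_cases hj : j = o
      · rw [hj]; exact h
      · exact hv0 j hj
    have h := congrFun hzv o
    simp only [Matrix.vecMul, dotProduct, Matrix.map_apply, c.offPart_apply_of_isOff ho,
      Pi.smul_apply, smul_eq_mul] at h
    rw [Finset.sum_eq_single o (fun j _ hj => by rw [hv0 j hj, zero_mul]) (by simp),
      mul_comm] at h
    rw [← hz, ← mul_right_cancel₀ hvo h, hnorm]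
  · rw [← hnorm]
    refine le_specRad_of_vecMul (v := Pi.single o 1) (by simp) (funext fun j => ?_)
    by_cases hj : j = o
    · subst hj
      simp [c.offPart_apply_of_isOff ho]
    · rw [hcol _ j hj]; simp [hj]

theorem ofReal_T_le_specRad_offPart {i j : Fin K} (hi : c.IsOff i) (hj : c.IsOff j) :
    ENNReal.ofReal (c.T i j) ≤ specRad c.offPart := by
  rw [c.specRad_offPart_of_isOff hj, hi.eq hj]

end ChannelModel

/-! ### Probabilities along the channel chain: visits, runs and rarity of on-slots. -/

namespace Randomness

variable {N M K : ℕ} {sensor : Fin N → SensorModel} {c : ChannelModel M K}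
  {Ω : Type*} [MeasurableSpace Ω] {μ : Measure Ω} (R : Randomness sensor c μ)

/-- Markov property: the conditional law of `h (t + 1)` given the past is the row `h t` of the
transition matrix. -/
theorem lintegral_markov {t : ℕ} {G : (ℕ → Fin K) → ℝ≥0∞}
    (hG : ∀ h h' : ℕ → Fin K, (∀ u ≤ t, h u = h' u) → G h = G h') (j : Fin K) :
    ∫⁻ ω, G (fun u => R.h u ω) * (if R.h (t + 1) ω = j then 1 else 0) ∂μ =
      ∫⁻ ω, G (fun u => R.h u ω) * ENNReal.ofReal (c.T (R.h t ω) j) ∂μ := by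
  -- A finite history is continued by a constant: `G` becomes a function on a finite type, and the
  -- field `markov`, stated for infinite sequences, can be applied.
  let ext : (Fin (t + 1) → Fin K) → Fin K → ℕ → Fin K := fun p k u =>
    if hu : u < t + 1 then p ⟨u, hu⟩ else k
  have hext : ∀ p k u (hu : u ≤ t), ext p k u = p ⟨u, Nat.lt_succ_of_le hu⟩ :=
    fun p k u hu => dif_pos (Nat.lt_succ_of_le hu)
  have hext' : ∀ p k, ext p k (t + 1) = k := fun p k => dif_neg (lt_irrefl _)
  let ρ : Ω → Fin (t + 1) → Fin K := fun ω u => R.h u ω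
  have hρ : Measurable ρ := measurable_pi_lambda _ fun u => R.measurable_h u
  let g : (Fin (t + 1) → Fin K) → ℝ≥0∞ := fun p => G (ext p (p 0))
  have hg : ∀ ω, G (fun u => R.h u ω) = g (ρ ω) := by
    intro ω
    refine hG _ _ fun u hu => ?_
    rw [hext _ _ u hu]
  have hset : ∀ p k, {ω | ρ ω = p} = {ω | ∀ u ≤ t, R.h u ω = ext p k u} := by
    intro p k
    refine Set.ext fun ω => ⟨?_, fun h => ?_⟩
    · rintro rfl u hu
      rw [hext _ _ u hu]
    · funext u
      have := h u (Nat.le_of_lt_succ u.2)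
      rwa [hext _ _ u (Nat.le_of_lt_succ u.2)] at this
  have hset' : ∀ p k, {ω | (ρ ω, R.h (t + 1) ω) = (p, k)} =
      {ω | ∀ u ≤ t + 1, R.h u ω = ext p k u} := by
    intro p k
    refine Set.ext fun ω => ?_
    have h1 : ω ∈ {ω | ρ ω = p} ↔ ω ∈ {ω | ∀ u ≤ t, R.h u ω = ext p k u} := by rw [hset p k]
    simp only [Set.mem_ofPred_eq, Prod.mk.injEq] at h1 ⊢
    rw [h1]
    constructor
    · rintro ⟨h2, h3⟩ u hu
      rcases Nat.le_succ_iff.1 hu with hu | rfl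
      · exact h2 u hu
      · rw [h3, hext']
    · intro h2
      exact ⟨fun u hu => h2 u (hu.trans t.le_succ), by rw [h2 _ le_rfl, hext']⟩
  have hmarkov : ∀ p k, μ {ω | (ρ ω, R.h (t + 1) ω) = (p, k)} =
      μ {ω | ρ ω = p} * ENNReal.ofReal (c.T (p (Fin.last t)) k) := by
    intro p k
    rw [hset' p k, hset p k, R.markov t (ext p k), hext', hext p k t le_rfl]
    rfl
  have hpair : Measurable fun ω => (ρ ω, R.h (t + 1) ω) := hρ.prodMk (R.measurable_h _)
  have hlhs : ∫⁻ ω, g (ρ ω) * (if R.h (t + 1) ω = j then 1 else 0) ∂μ =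
      ∑ p, g p * (μ {ω | ρ ω = p} * ENNReal.ofReal (c.T (p (Fin.last t)) j)) := by
    have h1 := lintegral_map (μ := μ) (f := fun x : (Fin (t + 1) → Fin K) × Fin K =>
      g x.1 * (if x.2 = j then 1 else 0)) (measurable_of_countable _) hpair
    rw [← h1, lintegral_fintype, Fintype.sum_prod_type]
    refine Finset.sum_congr rfl fun p _ => ?_
    rw [Finset.sum_eq_single j]
    · rw [Measure.map_apply hpair (measurableSet_singleton _), if_pos rfl, mul_one, ← hmarkov]
      rfl
    · intro k _ hk
      simp [hk]
    · simp
  have hrhs : ∫⁻ ω, g (ρ ω) * ENNReal.ofReal (c.T (R.h t ω) j) ∂μ =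
      ∑ p, g p * (μ {ω | ρ ω = p} * ENNReal.ofReal (c.T (p (Fin.last t)) j)) := by
    have h1 := lintegral_map (μ := μ) (f := fun p : Fin (t + 1) → Fin K =>
      g p * ENNReal.ofReal (c.T (p (Fin.last t)) j)) (measurable_of_countable _) hρ
    refine (show _ = ∫⁻ ω, g (ρ ω) * ENNReal.ofReal (c.T (ρ ω (Fin.last t)) j) ∂μ from rfl).trans ?_
    rw [← h1, lintegral_fintype]
    refine Finset.sum_congr rfl fun p _ => ?_
    rw [Measure.map_apply hρ (measurableSet_singleton _), mul_assoc, mul_comm (ENNReal.ofReal _)]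
    rfl
  simp_rw [hg]
  rw [hlhs, hrhs]

theorem measurable_comp_path {t : ℕ} {G : (ℕ → Fin K) → ℝ≥0∞}
    (hG : ∀ h h' : ℕ → Fin K, (∀ u ≤ t, h u = h' u) → G h = G h') :
    Measurable fun ω => G (fun u => R.h u ω) := by
  let ρ : Ω → Fin (t + 1) → Fin K := fun ω u => R.h u ω
  have hρ : Measurable ρ := measurable_pi_lambda _ fun u => R.measurable_h u
  have h : (fun ω => G (fun u => R.h u ω)) =
      (fun p : Fin (t + 1) → Fin K => G (fun u => p ⟨min u t, by omega⟩)) ∘ ρ := by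
    funext ω
    exact hG _ _ fun u hu => by simp [ρ, hu]
  rw [h]
  exact (measurable_of_countable _).comp hρ

theorem measurableSet_h_eq (t : ℕ) (j : Fin K) : MeasurableSet {ω | R.h t ω = j} :=
  R.measurable_h t (measurableSet_singleton j)

theorem sum_measure_h_eq [IsProbabilityMeasure μ] (t : ℕ) : ∑ j, μ {ω | R.h t ω = j} = 1 := by
  have h := sum_measure_preimage_singleton (μ := μ) (f := R.h t) Finset.univ
    fun j _ => R.measurableSet_h_eq t j
  rw [Finset.coe_univ, Set.preimage_univ, measure_univ] at h
  exact h

theorem measure_h_succ (t : ℕ) (j : Fin K) :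
    μ {ω | R.h (t + 1) ω = j} = ∑ i, μ {ω | R.h t ω = i} * ENNReal.ofReal (c.T i j) := by
  classical
  have h := R.lintegral_markov (t := t) (G := fun _ => 1) (fun _ _ _ => rfl) j
  simp only [one_mul] at h
  have h1 : ∫⁻ ω, (if R.h (t + 1) ω = j then 1 else 0) ∂μ = μ {ω | R.h (t + 1) ω = j} := by
    rw [← lintegral_indicator_one (R.measurableSet_h_eq (t + 1) j)]
    refine lintegral_congr fun ω => ?_
    simp [Set.indicator_apply]
  have h2 := lintegral_map (μ := μ) (f := fun i => ENNReal.ofReal (c.T i j))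
    (measurable_of_countable _) (R.measurable_h t)
  rw [← h1, h, ← h2, lintegral_fintype]
  refine Finset.sum_congr rfl fun i _ => ?_
  rw [Measure.map_apply (R.measurable_h t) (measurableSet_singleton _), mul_comm]
  rfl

theorem measure_h_add (t m : ℕ) (j : Fin K) :
    μ {ω | R.h (t + m) ω = j} =
      ∑ i, μ {ω | R.h t ω = i} * ENNReal.ofReal ((c.T ^ m) i j) := by
  induction m generalizing j with
  | zero => simp [Matrix.one_apply, apply_ite ENNReal.ofReal]
  | succ m ih =>
    rw [← add_assoc, R.measure_h_succ]
    simp_rw [ih, Finset.sum_mul]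
    rw [Finset.sum_comm]
    refine Finset.sum_congr rfl fun i _ => ?_
    rw [pow_succ, Matrix.mul_apply, ENNReal.ofReal_sum_of_nonneg fun l _ =>
      mul_nonneg (c.pow_nonneg m i l) (c.T_nonneg l j), Finset.mul_sum]
    refine Finset.sum_congr rfl fun l _ => ?_
    rw [ENNReal.ofReal_mul (c.pow_nonneg m i l), mul_assoc]

/-- Every vector channel state has infinite expected number of visits. -/
theorem tsum_measure_h_eq_top [IsProbabilityMeasure μ] (o : Fin K) :
    ∑' t, μ {ω | R.h t ω = o} = ∞ := by
  by_contra hne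
  -- By irreducibility, infinitely many expected visits to some `i` would force the same for `o`. If
  -- all states had finitely many, their total would be finite, yet each slot contributes `1`.
  have hfin : ∀ i, ∑' t, μ {ω | R.h t ω = i} ≠ ∞ := by
    intro i htop
    obtain ⟨m, hm⟩ := c.exists_pow_pos i o
    have h1 : ∑' t, μ {ω | R.h t ω = i} * ENNReal.ofReal ((c.T ^ m) i o) ≤
        ∑' t, μ {ω | R.h t ω = o} := by
      calc _ ≤ ∑' t, μ {ω | R.h (t + m) ω = o} := by
            refine ENNReal.tsum_le_tsum fun t => ?_
            rw [R.measure_h_add t m o]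
            exact Finset.single_le_sum
              (f := fun i => μ {ω | R.h t ω = i} * ENNReal.ofReal ((c.T ^ m) i o))
              (fun _ _ => bot_le) (Finset.mem_univ i)
        _ ≤ _ := ENNReal.tsum_comp_le_tsum_of_injective (add_left_injective m) _
    rw [ENNReal.tsum_mul_right, htop, ENNReal.top_mul (ENNReal.ofReal_pos.2 hm).ne'] at h1
    exact hne (top_le_iff.1 h1)
  have h2 : ∑ i, ∑' t, μ {ω | R.h t ω = i} ≠ ∞ := ENNReal.sum_ne_top.2 fun i _ => hfin i
  rw [← Summable.tsum_finsetSum fun i _ => ENNReal.summable] at h2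
  simp_rw [R.sum_measure_h_eq] at h2
  exact h2 (ENNReal.tsum_const_eq_top_of_ne_zero one_ne_zero)

/-- Probability of a run of one vector channel state. -/
theorem measure_run (o : Fin K) (s m : ℕ) :
    μ {ω | ∀ u ≤ m, R.h (s + u) ω = o} =
      μ {ω | R.h s ω = o} * ENNReal.ofReal (c.T o o) ^ m := by
  classical
  induction m with
  | zero => simp
  | succ m ih =>
    let G : (ℕ → Fin K) → ℝ≥0∞ := fun h => if ∀ u ≤ m, h (s + u) = o then 1 else 0
    have hG : ∀ h h' : ℕ → Fin K, (∀ u ≤ s + m, h u = h' u) → G h = G h' := by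
      intro h h' hh
      have : (∀ u ≤ m, h (s + u) = o) ↔ ∀ u ≤ m, h' (s + u) = o :=
        forall₂_congr fun u hu => by rw [hh _ (by omega)]
      simp only [G, this]
    have hms : ∀ m, MeasurableSet {ω | ∀ u ≤ m, R.h (s + u) ω = o} := by
      intro m
      have : {ω | ∀ u ≤ m, R.h (s + u) ω = o} = ⋂ u, ⋂ (_ : u ≤ m), {ω | R.h (s + u) ω = o} := by
        ext; simp
      rw [this]
      exact MeasurableSet.iInter fun u => MeasurableSet.iInter fun _ => R.measurableSet_h_eq _ _
    have h := R.lintegral_markov hG o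
    have h1 : ∫⁻ ω, G (fun u => R.h u ω) * (if R.h (s + m + 1) ω = o then 1 else 0) ∂μ =
        μ {ω | ∀ u ≤ m + 1, R.h (s + u) ω = o} := by
      rw [← lintegral_indicator_one (hms (m + 1))]
      refine lintegral_congr fun ω => ?_
      have hiff : (∀ u ≤ m + 1, R.h (s + u) ω = o) ↔
          (∀ u ≤ m, R.h (s + u) ω = o) ∧ R.h (s + m + 1) ω = o := by
        constructor
        · exact fun h => ⟨fun u hu => h u (by omega), h (m + 1) le_rfl⟩
        · rintro ⟨h, h'⟩ u hu
          rcases Nat.le_succ_iff.1 hu with hu | rfl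
          · exact h u hu
          · exact h'
      by_cases ha : ∀ u ≤ m, R.h (s + u) ω = o <;> by_cases hb : R.h (s + m + 1) ω = o <;>
        simp [G, Set.indicator_apply, ha, hb, hiff]
    have h2 : ∫⁻ ω, G (fun u => R.h u ω) * ENNReal.ofReal (c.T (R.h (s + m) ω) o) ∂μ =
        μ {ω | ∀ u ≤ m, R.h (s + u) ω = o} * ENNReal.ofReal (c.T o o) := by
      rw [← lintegral_indicator_one (hms m),
        ← lintegral_mul_const _ (measurable_one.indicator (hms m))]
      refine lintegral_congr fun ω => ?_
      by_cases ha : ∀ u ≤ m, R.h (s + u) ω = o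
      · simp [G, Set.indicator_apply, ha]
      · simp [G, ha]
    rw [← h1, h, h2, ih, pow_succ, mul_assoc]

/-- The probability that all channels are off, given the past. -/
theorem lintegral_isOff_succ_le {t : ℕ} {G : (ℕ → Fin K) → ℝ≥0∞} [DecidablePred c.IsOff]
    (hG : ∀ h h' : ℕ → Fin K, (∀ u ≤ t, h u = h' u) → G h = G h') :
    ∫⁻ ω, G (fun u => R.h u ω) * (if c.IsOff (R.h (t + 1) ω) then 1 else 0) ∂μ ≤
      ∫⁻ ω, G (fun u => R.h u ω) *
        (if c.IsOff (R.h t ω) then specRad c.offPart else 1) ∂μ := by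
  by_cases ho : ∃ o, c.IsOff o
  · obtain ⟨o, ho⟩ := ho
    have hiff : ∀ ω, c.IsOff (R.h (t + 1) ω) ↔ R.h (t + 1) ω = o :=
      fun ω => ⟨fun h => h.eq ho, fun h => h ▸ ho⟩
    simp_rw [hiff]
    rw [R.lintegral_markov hG o]
    refine lintegral_mono fun ω => ?_
    gcongr
    split_ifs with h
    · exact c.ofReal_T_le_specRad_offPart h ho
    · exact ENNReal.ofReal_le_one.2 (c.T_le_one _ _)
  · have hno : ∀ ω, ¬ c.IsOff (R.h (t + 1) ω) := fun ω h => ho ⟨_, h⟩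
    simp [hno]

open Classical in
/-- Number of slots among `s, …, s + k - 1` in which some channel is on. -/
noncomputable def _root_.RemoteEst.ChannelModel.onCount (c : ChannelModel M K) (h : ℕ → Fin K)
    (s : ℕ) : ℕ → ℕ
  | 0 => 0
  | k + 1 => onCount c h s k + if c.IsOff (h (s + k)) then 0 else 1

theorem _root_.RemoteEst.ChannelModel.onCount_congr (c : ChannelModel M K) {h h' : ℕ → Fin K}
    {s k : ℕ} (hh : ∀ u < s + k, h u = h' u) : c.onCount h s k = c.onCount h' s k := by
  induction k with
  | zero => rfl
  | succ k ih =>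
    rw [ChannelModel.onCount, ChannelModel.onCount, ih fun u hu => hh u (by omega),
      hh (s + k) (by omega)]

/-- Exponential bound for the probability that channels are rarely on. -/
theorem exists_measure_onCount_lt_le [IsProbabilityMeasure μ] {r : NNReal}
    (hr : specRad c.offPart < r) (L : ℕ) :
    ∃ D : NNReal, ∀ s k, μ {ω | c.onCount (fun u => R.h u ω) s k < L} ≤ D * (r : ℝ≥0∞) ^ k := by
  classical
  obtain ⟨p, hp⟩ : ∃ p : NNReal, (p : ℝ≥0∞) = specRad c.offPart :=
    ⟨_, ENNReal.coe_toNNReal (specRad_ne_top c.offPart)⟩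
  have hpr : p < r := by rw [← hp] at hr; exact_mod_cast hr
  have hr0 : 0 < r := bot_le.trans_lt hpr
  -- The weight is `1` on the off state and `β` elsewhere, and each on-slot is discounted by `z`.
  -- The two inequalities say that one step multiplies the weighted moment by at most `r`, from an
  -- off and from an on state. `β = 2 / r + 1` gives `r * β = 2 + r`, and `z` is small enough that
  -- `β * z ≤ min (r - p) 1`.
  obtain ⟨β, z, hβ, hz0, hz1, h1, h2⟩ : ∃ β z : NNReal, 1 ≤ β ∧ 0 < z ∧ z ≤ 1 ∧
      p + β * z ≤ r ∧ 1 + β * z ≤ r * β := by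
    have hβ : (0 : NNReal) < 2 / r + 1 := by positivity
    refine ⟨2 / r + 1, min 1 (min (r - p) 1 / (2 / r + 1)), by simp, ?_, min_le_left _ _, ?_, ?_⟩
    · have : 0 < r - p := tsub_pos_of_lt hpr
      positivity
    · calc _ ≤ p + (2 / r + 1) * (min (r - p) 1 / (2 / r + 1)) := by
            gcongr; exact min_le_right _ _
        _ = p + min (r - p) 1 := by rw [mul_div_cancel₀ _ hβ.ne']
        _ ≤ p + (r - p) := by gcongr; exact min_le_left _ _
        _ = r := add_tsub_cancel_of_le hpr.le
    · calc _ ≤ 1 + (2 / r + 1) * (min (r - p) 1 / (2 / r + 1)) := by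
            gcongr; exact min_le_right _ _
        _ = 1 + min (r - p) 1 := by rw [mul_div_cancel₀ _ hβ.ne']
        _ ≤ 1 + 1 := by gcongr; exact min_le_right _ _
        _ ≤ 2 + r := by rw [one_add_one_eq_two]; exact le_self_add
        _ = r * (2 / r + 1) := by rw [mul_add, mul_div_cancel₀ _ hr0.ne', mul_one]
  let Z : ℕ → ℕ → (ℕ → Fin K) → ℝ≥0∞ := fun s k h => (z : ℝ≥0∞) ^ c.onCount h s k
  have hZ : ∀ s k h h', (∀ u ≤ s + k, h u = h' u) → Z s (k + 1) h = Z s (k + 1) h' := by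
    intro s k h h' hh
    simp only [Z]
    rw [c.onCount_congr fun u hu => hh u (by omega)]
  let wt : Fin K → ℝ≥0∞ := fun j => if c.IsOff j then 1 else β
  have hwt : ∀ j, wt j ≤ β := by
    intro j; simp only [wt]; split_ifs
    · exact_mod_cast hβ
    · exact le_rfl
  have hwt1 : ∀ j, 1 ≤ wt j := by
    intro j; simp only [wt]; split_ifs
    · exact le_rfl
    · exact_mod_cast hβ
  have hzle : (z : ℝ≥0∞) ≤ 1 := by exact_mod_cast hz1
  -- This exponential moment counts the slots `s, …, s + k` and weighs the state in the last of
  -- them.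
  let Φ : ℕ → ℕ → ℝ≥0∞ := fun s k =>
    ∫⁻ ω, Z s (k + 1) (fun u => R.h u ω) * wt (R.h (s + k) ω) ∂μ
  have hΦ0 : ∀ s, Φ s 0 ≤ β := by
    intro s
    calc Φ s 0 ≤ ∫⁻ ω, β ∂μ := by
          refine lintegral_mono fun ω => ?_
          calc _ ≤ 1 * (β : ℝ≥0∞) := by
                gcongr
                · exact pow_le_one₀ bot_le hzle
                · exact hwt _
            _ = β := one_mul _
      _ = β := by simp
  have hΦ : ∀ s k, Φ s (k + 1) ≤ r * Φ s k := by
    intro s k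
    have hsplit : ∀ ω, Z s (k + 1 + 1) (fun u => R.h u ω) * wt (R.h (s + (k + 1)) ω) ≤
        Z s (k + 1) (fun u => R.h u ω) * (if c.IsOff (R.h (s + k + 1) ω) then 1 else 0) +
          Z s (k + 1) (fun u => R.h u ω) * (β * z) := by
      intro ω
      simp only [Z, wt, ChannelModel.onCount, ← add_assoc]
      by_cases ho : c.IsOff (R.h (s + k + 1) ω)
      · simp [ho]
      · simp only [ho, if_false]
        rw [pow_succ, mul_zero, zero_add, mul_assoc, mul_comm (z : ℝ≥0∞)]
    have hmZ : Measurable fun ω => Z s (k + 1) (fun u => R.h u ω) :=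
      R.measurable_comp_path (hZ s k)
    calc Φ s (k + 1) ≤ _ := lintegral_mono hsplit
      _ = _ := lintegral_add_right _ (hmZ.mul_const _)
      _ ≤ (∫⁻ ω, Z s (k + 1) (fun u => R.h u ω) *
            (if c.IsOff (R.h (s + k) ω) then specRad c.offPart else 1) ∂μ) +
          ∫⁻ ω, Z s (k + 1) (fun u => R.h u ω) * (β * z) ∂μ := by
        exact add_le_add_left (R.lintegral_isOff_succ_le (hZ s k)) _
      _ = ∫⁻ ω, (Z s (k + 1) (fun u => R.h u ω) *
            (if c.IsOff (R.h (s + k) ω) then specRad c.offPart else 1) +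
          Z s (k + 1) (fun u => R.h u ω) * (β * z)) ∂μ :=
        (lintegral_add_right _ (hmZ.mul_const _)).symm
      _ ≤ ∫⁻ ω, r * (Z s (k + 1) (fun u => R.h u ω) * wt (R.h (s + k) ω)) ∂μ := by
        refine lintegral_mono fun ω => ?_
        rw [← mul_add, mul_left_comm]
        gcongr
        simp only [wt]
        split_ifs
        · rw [← hp, mul_one]; exact_mod_cast h1
        · exact_mod_cast h2
      _ = r * Φ s k := lintegral_const_mul' _ _ ENNReal.coe_ne_top
  have hΦk : ∀ s k, Φ s k ≤ β * (r : ℝ≥0∞) ^ k := by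
    intro s k
    induction k with
    | zero => simpa using hΦ0 s
    | succ k ih =>
      calc Φ s (k + 1) ≤ r * Φ s k := hΦ s k
        _ ≤ r * (β * (r : ℝ≥0∞) ^ k) := by gcongr
        _ = _ := by rw [pow_succ]; ring
  have hzL : (0 : NNReal) < z ^ L := pow_pos hz0 L
  -- Fewer than `L` on-slots means `z ^ count ≥ z ^ L`, so Markov's inequality gives `β / z ^ L`.
  -- The extra `r` is the shift from `k` to `k + 1`; the summand `1` covers `k = 0`.
  refine ⟨1 + β / (z ^ L * r), fun s k => ?_⟩
  cases k with
  | zero =>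
    refine prob_le_one.trans ?_
    simp
  | succ k =>
    have hsub : ∀ ω, {ω | c.onCount (fun u => R.h u ω) s (k + 1) < L}.indicator
        (fun _ => (z : ℝ≥0∞) ^ L) ω ≤
        Z s (k + 1) (fun u => R.h u ω) * wt (R.h (s + k) ω) := by
      intro ω
      by_cases hω : c.onCount (fun u => R.h u ω) s (k + 1) < L
      · rw [Set.indicator_of_mem (by exact hω)]
        calc (z : ℝ≥0∞) ^ L ≤ Z s (k + 1) (fun u => R.h u ω) :=
              pow_le_pow_of_le_one bot_le hzle hω.le
          _ ≤ _ := le_mul_of_one_le_right bot_le (hwt1 _)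
      · rw [Set.indicator_of_notMem (by exact hω)]; exact bot_le
    have hms : MeasurableSet {ω | c.onCount (fun u => R.h u ω) s (k + 1) < L} := by
      have h := R.measurable_comp_path (t := s + k)
        (G := fun h => (c.onCount h s (k + 1) : ℝ≥0∞))
        (fun h h' hh => by rw [c.onCount_congr fun u hu => hh u (by omega)])
      have h' := h (measurableSet_Iio (a := (L : ℝ≥0∞)))
      convert h' using 1
      ext ω
      simp
    have h3 : (z : ℝ≥0∞) ^ L * μ {ω | c.onCount (fun u => R.h u ω) s (k + 1) < L} ≤
        β * (r : ℝ≥0∞) ^ k := by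
      rw [← lintegral_indicator_const hms]
      exact (lintegral_mono hsub).trans (hΦk s k)
    have hzL' : ((z : ℝ≥0∞) ^ L) ≠ 0 := by exact_mod_cast hzL.ne'
    have hzLt : ((z : ℝ≥0∞) ^ L) ≠ ∞ := by exact_mod_cast ENNReal.coe_ne_top (r := z ^ L)
    rw [mul_comm, ← ENNReal.le_div_iff_mul_le (.inl hzL') (.inl hzLt)] at h3
    refine h3.trans ?_
    have h4 : (β * (r : ℝ≥0∞) ^ k) / (z : ℝ≥0∞) ^ L =
        ((β / (z ^ L * r) * r ^ (k + 1) : NNReal) : ℝ≥0∞) := by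
      have h5 : β / (z ^ L * r) * r ^ (k + 1) = β * r ^ k / z ^ L := by
        rw [pow_succ]; field_simp
      rw [h5, ENNReal.coe_div hzL.ne']
      push_cast
      rfl
    rw [h4]
    have h6 : β / (z ^ L * r) * r ^ (k + 1) ≤ (1 + β / (z ^ L * r)) * r ^ (k + 1) := by
      gcongr; exact le_add_self
    exact_mod_cast h6

end Randomness

/-! ### Pathwise bounds on the ages. -/

section Policies

variable {N M K : ℕ} (c : ChannelModel M K) (π : Policy N M K)

theorem aoi_succ_of_not_arrives {h : ℕ → Fin K} {t : ℕ} {n : Fin N}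
    (hn : ¬ Arrives c π (aoi c π h (t + 1)) (h t) (h (t + 1)) n) :
    aoi c π h (t + 2) n = aoi c π h (t + 1) n + 1 := if_neg hn

theorem aoi_succ_of_arrives {h : ℕ → Fin K} {t : ℕ} {n : Fin N}
    (hn : Arrives c π (aoi c π h (t + 1)) (h t) (h (t + 1)) n) :
    aoi c π h (t + 2) n = 1 := if_pos hn

theorem not_arrives_of_isOff {φ : Fin N → ℕ} {i j : Fin K} (hj : c.IsOff j) (n : Fin N) :
    ¬ Arrives c π φ i j n := by
  rintro ⟨m, -, hm⟩
  rw [hj m] at hm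
  exact Bool.false_ne_true hm

/-- The age exceeds the length of the current run of all-off states, whatever the policy. -/
theorem lt_aoi_of_run {h : ℕ → Fin K} {s m : ℕ} (n : Fin N)
    (hs : ∀ u ≤ m, c.IsOff (h (s + 1 + u))) : m + 1 < aoi c π h (s + m + 2) n := by
  induction m with
  | zero =>
    have h1 := one_le_aoi c π h s n
    have h2 := aoi_succ_of_not_arrives c π (h := h) (t := s) (n := n)
      (not_arrives_of_isOff c π (hs 0 le_rfl) n)
    rw [add_zero, h2]
    omega
  | succ m ih =>
    have h1 := ih fun u hu => hs u (by omega)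
    have h2 := aoi_succ_of_not_arrives c π (h := h) (t := s + m + 1) (n := n)
      (not_arrives_of_isOff c π (by
        have := hs (m + 1) le_rfl
        rwa [show s + 1 + (m + 1) = s + m + 1 + 1 by omega] at this) n)
    rw [show s + (m + 1) + 2 = s + m + 1 + 2 by omega, h2]
    exact Nat.succ_lt_succ h1

/-- A sensor of maximal age. -/
noncomputable def oldest [NeZero N] (φ : Fin N → ℕ) : Fin N := (Finite.exists_max φ).choose

theorem le_oldest [NeZero N] (φ : Fin N → ℕ) (n : Fin N) : φ n ≤ φ (oldest φ) :=
  (Finite.exists_max φ).choose_spec n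

/-- All channels carry the packet of a sensor of maximal age. -/
noncomputable def maxAgePolicy (N M K : ℕ) [NeZero N] : Policy N M K :=
  fun φ _ _ => some (oldest φ)

theorem arrives_maxAgePolicy_iff [NeZero N] {φ : Fin N → ℕ} {i j : Fin K} {n : Fin N} :
    Arrives c (maxAgePolicy N M K) φ i j n ↔ n = oldest φ ∧ ¬ c.IsOff j := by
  simp only [Arrives, maxAgePolicy, ChannelModel.IsOff, Option.some.injEq, not_forall,
    Bool.not_eq_false, exists_and_left, eq_comm (a := n)]

/-- Under the maximal-age policy, the number of receptions since the last one of sensor `n` is at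
most the number of sensors that are younger than `n`. -/
theorem onCount_le_card_younger [NeZero N] (h : ℕ → Fin K) (s k : ℕ) (n : Fin N)
    (hk : k < aoi c (maxAgePolicy N M K) h (s + 1 + k) n) :
    c.onCount h (s + 1) k ≤ (Finset.univ.filter fun m =>
      aoi c (maxAgePolicy N M K) h (s + 1 + k) m <
        aoi c (maxAgePolicy N M K) h (s + 1 + k) n).card := by
  classical
  induction k with
  | zero => exact bot_le
  | succ k ih =>
    set π := maxAgePolicy N M K
    have e1 : s + 1 + (k + 1) = s + k + 2 := by omega
    have e2 : s + 1 + k = s + k + 1 := by omega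
    rw [e1] at hk ⊢
    rw [ChannelModel.onCount, e2]
    rw [e2] at ih
    have hn : ¬ Arrives c π (aoi c π h (s + k + 1)) (h (s + k)) (h (s + k + 1)) n := by
      intro hn
      rw [aoi_succ_of_arrives c π hn] at hk
      omega
    have hage := aoi_succ_of_not_arrives c π hn
    have ih' := ih (by omega)
    have hone := one_le_aoi c π h (s + k) n
    by_cases ho : c.IsOff (h (s + k + 1))
    · rw [if_pos ho, add_zero]
      refine ih'.trans (Finset.card_le_card fun m hm => ?_)
      rw [Finset.mem_filter] at hm ⊢
      rw [hage, aoi_succ_of_not_arrives c π (not_arrives_of_isOff c π ho m)]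
      exact ⟨hm.1, Nat.succ_lt_succ hm.2⟩
    · rw [if_neg ho]
      -- The received sensor `g` has maximal age, so it was not younger than `n`; after its reset it
      -- is. Sensors already younger than `n` stay so, since the age of `n` also grows by one.
      set g := oldest (aoi c π h (s + k + 1)) with hg
      have hnotMem : g ∉ Finset.univ.filter fun m =>
          aoi c π h (s + k + 1) m < aoi c π h (s + k + 1) n := by
        rw [Finset.mem_filter, not_and, not_lt]
        exact fun _ => le_oldest _ n
      calc _ ≤ _ := Nat.succ_le_succ ih'
        _ = _ := (Finset.card_insert_of_notMem hnotMem).symm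
        _ ≤ _ := by
          refine Finset.card_le_card fun m hm => ?_
          rw [Finset.mem_filter]
          refine ⟨Finset.mem_univ m, ?_⟩
          by_cases hm' : m = g
          · rw [hage, aoi_succ_of_arrives c π ((arrives_maxAgePolicy_iff c).2 ⟨hm', ho⟩)]
            omega
          · rw [hage, aoi_succ_of_not_arrives c π
              fun ha => hm' ((arrives_maxAgePolicy_iff c).1 ha).1]
            exact Nat.succ_lt_succ
              (Finset.mem_filter.1 (Finset.mem_of_mem_insert_of_ne hm hm')).2

/-- No sensor is younger than itself, so at most `N - 1` sensors are younger than `n`. -/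
theorem onCount_lt_of_lt_aoi [NeZero N] (h : ℕ → Fin K) (s k : ℕ) (n : Fin N)
    (hk : k < aoi c (maxAgePolicy N M K) h (s + 1 + k) n) : c.onCount h (s + 1) k < N := by
  refine (onCount_le_card_younger c h s k n hk).trans_lt ?_
  have h1 := Finset.card_lt_card (Finset.filter_ssubset (p := fun m =>
    aoi c (maxAgePolicy N M K) h (s + 1 + k) m < aoi c (maxAgePolicy N M K) h (s + 1 + k) n).2
    ⟨n, Finset.mem_univ n, lt_irrefl _⟩)
  simpa using h1

end Policies

/-! ### Long-run averages and choice of rates. -/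

section Averages

theorem limsup_average_le {f : ℕ → ℝ≥0∞} {B : ℝ≥0∞} (hf : ∀ t, f (t + 1) ≤ B) :
    limsup (fun T : ℕ => (∑ t ∈ Finset.Icc 1 T, f t) / (T : ℝ≥0∞)) atTop ≤ B := by
  refine limsup_le_of_le (h := Eventually.of_forall fun T => ?_)
  refine ENNReal.div_le_of_le_mul ?_
  calc ∑ t ∈ Finset.Icc 1 T, f t ≤ ∑ t ∈ Finset.Icc 1 T, B := by
        refine Finset.sum_le_sum fun t ht => ?_
        obtain ⟨s, rfl⟩ := Nat.exists_eq_succ_of_ne_zero (by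
          have := (Finset.mem_Icc.1 ht).1; omega : t ≠ 0)
        exact hf s
    _ = B * T := by simp [mul_comm]

theorem limsup_average_eq_top {f : ℕ → ℝ≥0∞} (hf : Tendsto f atTop (nhds ∞)) :
    limsup (fun T : ℕ => (∑ t ∈ Finset.Icc 1 T, f t) / (T : ℝ≥0∞)) atTop = ∞ := by
  refine Tendsto.limsup_eq (ENNReal.tendsto_nhds_top_iff_nat.2 fun B => ?_)
  obtain ⟨t₀, ht₀⟩ := eventually_atTop.1
    (ENNReal.tendsto_nhds_top_iff_nat.1 hf (2 * (B + 1)))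
  -- From here on at least half of the slots up to `T` come after `t₀`, each contributing at least
  -- `2 * (B + 1)`, so the average is at least `B + 1`.
  refine eventually_atTop.2 ⟨2 * t₀ + 1, fun T hT => ?_⟩
  have hT0 : (T : ℝ≥0∞) ≠ 0 := by exact_mod_cast (by omega : T ≠ 0)
  have h1 : ((B + 1 : ℕ) : ℝ≥0∞) * T ≤ ∑ t ∈ Finset.Icc 1 T, f t := by
    calc ((B + 1 : ℕ) : ℝ≥0∞) * T ≤ ((T - t₀ : ℕ) : ℝ≥0∞) * (2 * (B + 1) : ℕ) := by
          have : (B + 1) * T ≤ (T - t₀) * (2 * (B + 1)) := by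
            have h2 : T ≤ 2 * (T - t₀) := by omega
            nlinarith
          exact_mod_cast this
      _ = ∑ t ∈ Finset.Icc (t₀ + 1) T, ((2 * (B + 1) : ℕ) : ℝ≥0∞) := by
          rw [Finset.sum_const, Nat.card_Icc, Nat.add_sub_add_right, nsmul_eq_mul]
      _ ≤ ∑ t ∈ Finset.Icc (t₀ + 1) T, f t := by
          refine Finset.sum_le_sum fun t ht => (ht₀ t ?_).le
          have := (Finset.mem_Icc.1 ht).1
          omega
      _ ≤ _ := Finset.sum_le_sum_of_subset (Finset.Icc_subset_Icc_left (by omega))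
  rw [← ENNReal.le_div_iff_mul_le (.inl hT0) (.inl (ENNReal.natCast_ne_top T))] at h1
  exact lt_of_lt_of_le (by exact_mod_cast B.lt_succ_self) h1

/-- The geometric bounds hold only at rates strictly above the spectral radii; continuity turns the
strict inequality into room for both. -/
theorem exists_rates {a b : ℝ≥0∞} (ha : a ≠ ∞) (hb : b ≠ ∞) (hab : a ^ 2 * b < 1) :
    ∃ q r : NNReal, a < q ∧ b < r ∧ q ^ 2 * r < 1 := by
  lift a to NNReal using ha
  lift b to NNReal using hb
  have hcont : Continuous fun ε : NNReal => (a + ε) ^ 2 * (b + ε) := by fun_prop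
  have h0 : (a + 0) ^ 2 * (b + 0) < 1 := by
    rw [add_zero, add_zero]; exact_mod_cast hab
  have hev := (hcont.tendsto 0).eventually (gt_mem_nhds h0)
  obtain ⟨ε, hε, hε0⟩ := ((hev.filter_mono nhdsWithin_le_nhds).and
    (self_mem_nhdsWithin (a := (0 : NNReal)) (s := Set.Ioi 0))).exists
  have hε0' : 0 < ε := hε0
  exact ⟨a + ε, b + ε, by exact_mod_cast lt_add_of_pos_right a hε0',
    by exact_mod_cast lt_add_of_pos_right b hε0', hε⟩

end Averages

/-! ### Boundedness and divergence of the mean-square error. -/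

namespace Randomness

variable {N M K : ℕ} {sensor : Fin N → SensorModel} {c : ChannelModel M K}
  {Ω : Type*} [MeasurableSpace Ω] {μ : Measure Ω} (R : Randomness sensor c μ)

/-- Layer-cake formula: a partial geometric sum up to the age becomes a sum over tail probabilities
of the age. -/
theorem lintegral_sum_range_aoi (π : Policy N M K) (n : Fin N) (t : ℕ) (x : ℝ≥0∞) :
    ∫⁻ ω, ∑ i ∈ Finset.range (aoi c π (fun u => R.h u ω) (t + 1) n), x ^ i ∂μ =
      ∑ i ∈ Finset.range (t + 1), x ^ i * μ {ω | i < aoi c π (fun u => R.h u ω) (t + 1) n} := by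
  have hm : Measurable fun ω => aoi c π (fun u => R.h u ω) (t + 1) n :=
    ((measurable_pi_apply n).comp (measurable_aoi c π (t + 1))).comp R.measurable_path
  have hset : ∀ i, MeasurableSet {ω | i < aoi c π (fun u => R.h u ω) (t + 1) n} :=
    fun i => hm measurableSet_Ioi
  have h : ∀ ω, ∑ i ∈ Finset.range (aoi c π (fun u => R.h u ω) (t + 1) n), x ^ i =
      ∑ i ∈ Finset.range (t + 1),
        {ω | i < aoi c π (fun u => R.h u ω) (t + 1) n}.indicator (fun _ => x ^ i) ω := by
    intro ω
    have hle := aoi_le c π (fun u => R.h u ω) t n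
    have hr : Finset.range (aoi c π (fun u => R.h u ω) (t + 1) n) =
        (Finset.range (t + 1)).filter (· < aoi c π (fun u => R.h u ω) (t + 1) n) := by
      ext i; simp only [Finset.mem_range, Finset.mem_filter]; omega
    rw [hr, Finset.sum_filter]
    simp only [Set.indicator_apply, Set.mem_ofPred_eq]
  simp_rw [h]
  rw [lintegral_finsetSum _ fun i _ => measurable_const.indicator (hset i)]
  exact Finset.sum_congr rfl fun i _ => lintegral_indicator_const (hset i) _

variable [IsProbabilityMeasure μ]

/-- Under the maximal-age policy the mean-square errors are bounded. -/
theorem exists_mse_maxAgePolicy_le [NeZero N] (n : Fin N) {q r : NNReal}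
    (hq : specRad (sensor n).A < q) (hr : specRad c.offPart < r) (hqr : q ^ 2 * r < 1) :
    ∃ B : NNReal, ∀ t, R.mse (maxAgePolicy N M K) n (t + 1) ≤ B := by
  obtain ⟨C, hC, htr⟩ := (sensor n).exists_trace_openCov_le (q := q)
    (by rwa [ENNReal.ofReal_coe_nnreal])
  obtain ⟨D, hD⟩ := R.exists_measure_onCount_lt_le hr N
  have hqr' : ((q : ℝ≥0∞) ^ 2 * r) < 1 := by exact_mod_cast hqr
  set B : ℝ≥0∞ := ENNReal.ofReal C * (1 + D * (1 - (q : ℝ≥0∞) ^ 2 * r)⁻¹) with hB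
  have hBtop : B ≠ ∞ := by
    refine ENNReal.mul_ne_top ENNReal.ofReal_ne_top (ENNReal.add_ne_top.2
      ⟨ENNReal.one_ne_top, ENNReal.mul_ne_top ENNReal.coe_ne_top ?_⟩)
    exact ENNReal.inv_ne_top.2 (tsub_pos_of_lt hqr').ne'
  refine ⟨B.toNNReal, fun t => ?_⟩
  rw [ENNReal.coe_toNNReal hBtop, R.mse_eq]
  calc _ ≤ ∫⁻ ω, ENNReal.ofReal C * (1 + ∑ i ∈ Finset.range
          (aoi c (maxAgePolicy N M K) (fun u => R.h u ω) (t + 1) n), ((q : ℝ≥0∞) ^ 2) ^ i) ∂μ := by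
        refine lintegral_mono fun ω => (ENNReal.ofReal_le_ofReal (htr _)).trans_eq ?_
        rw [ENNReal.ofReal_mul hC, ENNReal.ofReal_add zero_le_one (by positivity),
          ENNReal.ofReal_one, ENNReal.ofReal_sum_of_nonneg fun i _ => by positivity]
        congr 2
        refine Finset.sum_congr rfl fun i _ => ?_
        rw [ENNReal.ofReal_pow (by positivity), ENNReal.ofReal_pow (by positivity),
          ENNReal.ofReal_coe_nnreal]
    _ = ENNReal.ofReal C * (1 + ∑ i ∈ Finset.range (t + 1), ((q : ℝ≥0∞) ^ 2) ^ i *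
          μ {ω | i < aoi c (maxAgePolicy N M K) (fun u => R.h u ω) (t + 1) n}) := by
        rw [lintegral_const_mul' _ _ ENNReal.ofReal_ne_top, lintegral_add_left measurable_const,
          R.lintegral_sum_range_aoi, lintegral_one, measure_univ]
    _ ≤ ENNReal.ofReal C * (1 + ∑ i ∈ Finset.range (t + 1), D * ((q : ℝ≥0∞) ^ 2 * r) ^ i) := by
        gcongr ENNReal.ofReal C * (1 + ∑ i ∈ _, ?_) with i hi
        have hit : i ≤ t := Nat.lt_succ_iff.1 (Finset.mem_range.1 hi)
        have h1 : μ {ω | i < aoi c (maxAgePolicy N M K) (fun u => R.h u ω) (t + 1) n} ≤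
            D * (r : ℝ≥0∞) ^ i := by
          -- The relevant window is the `i` slots `t - i + 1, …, t` before slot `t + 1`.
          refine (measure_mono fun ω hω => ?_).trans (hD (t - i + 1) i)
          refine onCount_lt_of_lt_aoi c _ (t - i) i n ?_
          rw [show t - i + 1 + i = t + 1 by omega]
          exact hω
        calc _ ≤ ((q : ℝ≥0∞) ^ 2) ^ i * (D * (r : ℝ≥0∞) ^ i) := by gcongr
          _ = _ := by rw [mul_pow]; ring
    _ ≤ B := by
        rw [hB, ← Finset.mul_sum, ← ENNReal.tsum_geometric]
        gcongr
        exact ENNReal.sum_le_tsum _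

/-- When `ρ² p ≥ 1` for an all-off state with holding probability `p`, the mean-square errors
diverge under every policy. -/
theorem tendsto_mse_nhds_top (π : Policy N M K) (n : Fin N)
    (h : 1 ≤ specRad (sensor n).A ^ 2 * specRad c.offPart) :
    Tendsto (R.mse π n) atTop (nhds ∞) := by
  obtain ⟨o, ho⟩ : ∃ o, c.IsOff o := by
    by_contra hno
    rw [c.specRad_offPart_of_forall_not_isOff fun j hj => hno ⟨j, hj⟩, mul_zero] at h
    exact absurd h (by simp)
  rw [c.specRad_offPart_of_isOff ho] at h
  set p := ENNReal.ofReal (c.T o o) with hp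
  have hp1 : p ≤ 1 := ENNReal.ofReal_le_one.2 (c.T_le_one o o)
  have hρ : 1 ≤ specRad (sensor n).A := by
    have h1 : 1 ≤ specRad (sensor n).A ^ 2 := h.trans (mul_le_of_le_one_right bot_le hp1)
    by_contra hlt
    exact absurd h1 (not_le.2 (pow_lt_one₀ bot_le (not_le.1 hlt) two_ne_zero))
  obtain ⟨z, v, hv, hzv, hz⟩ := exists_vecMul_of_specRad_ne_zero
    (zero_lt_one.trans_le hρ).ne'
  have hz1 : 1 ≤ ‖z‖ := by
    rw [← hz] at hρ
    have : 1 ≤ ‖z‖₊ := by exact_mod_cast hρ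
    exact_mod_cast this
  obtain ⟨d, hd, hle⟩ := (sensor n).exists_le_trace_openCov hz1 hv hzv
  set x := specRad (sensor n).A ^ 2 with hx
  have hxz : ENNReal.ofReal (‖z‖ ^ 2) = x := by
    rw [hx, ← hz, ENNReal.ofReal_pow (norm_nonneg z), ofReal_norm, enorm_eq_nnnorm]
  have hlow : ∀ t, ENNReal.ofReal d * ∑ m ∈ Finset.range t, μ {ω | R.h (m + 1) ω = o} ≤
      R.mse π n (t + 1) := by
    intro t
    -- Reversing the order makes `m + 1` the length of an off-run that starts in slot `t - m` and
    -- ends in slot `t`.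
    calc _ = ENNReal.ofReal d * ∑ m ∈ Finset.range t, μ {ω | R.h (t - 1 - m + 1) ω = o} := by
          rw [Finset.sum_range_reflect (fun m => μ {ω | R.h (m + 1) ω = o})]
      _ ≤ ENNReal.ofReal d * ∑ m ∈ Finset.range t, x ^ (m + 1) *
            μ {ω | m + 1 < aoi c π (fun u => R.h u ω) (t + 1) n} := by
          gcongr with m hm
          have hmt := Finset.mem_range.1 hm
          have h1 : μ {ω | R.h (t - 1 - m + 1) ω = o} * p ^ m ≤
              μ {ω | m + 1 < aoi c π (fun u => R.h u ω) (t + 1) n} := by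
            rw [← R.measure_run]
            refine measure_mono fun ω hω => ?_
            have h2 := lt_aoi_of_run c π (h := fun u => R.h u ω) (s := t - 1 - m) (m := m) n
              fun u hu => by
                have h3 : R.h (t - 1 - m + 1 + u) ω = o := hω u hu
                simp only [h3]
                exact ho
            rwa [show t - 1 - m + m + 2 = t + 1 by omega] at h2
          -- Since `x * p ≥ 1`, the factor `(x * p) ^ (m + 1)` comes for free. A run of `m + 1`
          -- slots costs only `p ^ m`, and the spare `p ≤ 1` is discarded.
          calc μ {ω | R.h (t - 1 - m + 1) ω = o}
              ≤ (x * p) ^ (m + 1) * μ {ω | R.h (t - 1 - m + 1) ω = o} :=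
                le_mul_of_one_le_left bot_le (one_le_pow₀ h)
            _ = p * (x ^ (m + 1) * (μ {ω | R.h (t - 1 - m + 1) ω = o} * p ^ m)) := by
                rw [mul_pow, pow_succ p]; ring
            _ ≤ 1 * (x ^ (m + 1) *
                μ {ω | m + 1 < aoi c π (fun u => R.h u ω) (t + 1) n}) := by gcongr
            _ = _ := one_mul _
      _ ≤ ENNReal.ofReal d * ∑ i ∈ Finset.range (t + 1), x ^ i *
            μ {ω | i < aoi c π (fun u => R.h u ω) (t + 1) n} := by
          rw [Finset.sum_range_succ']
          gcongr
          exact le_self_add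
      _ = ∫⁻ ω, ENNReal.ofReal d * ∑ i ∈ Finset.range
            (aoi c π (fun u => R.h u ω) (t + 1) n), x ^ i ∂μ := by
          rw [lintegral_const_mul' _ _ ENNReal.ofReal_ne_top, R.lintegral_sum_range_aoi]
      _ ≤ R.mse π n (t + 1) := by
          rw [R.mse_eq]
          refine lintegral_mono fun ω => le_trans (le_of_eq ?_) (ENNReal.ofReal_le_ofReal (hle _))
          rw [ENNReal.ofReal_mul hd.le, ENNReal.ofReal_sum_of_nonneg fun i _ => by positivity,
            ← hxz]
          simp_rw [ENNReal.ofReal_pow (sq_nonneg ‖z‖)]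
  have htsum : ∑' m, μ {ω | R.h (m + 1) ω = o} = ∞ := by
    have h1 := R.tsum_measure_h_eq_top o
    rw [tsum_eq_zero_add' ENNReal.summable] at h1
    exact (ENNReal.add_eq_top.1 h1).resolve_left (measure_ne_top _ _)
  have hsum : Tendsto (fun t => ENNReal.ofReal d *
      ∑ m ∈ Finset.range t, μ {ω | R.h (m + 1) ω = o}) atTop (nhds ∞) := by
    have h1 := ENNReal.Tendsto.const_mul (a := ENNReal.ofReal d)
      (ENNReal.tendsto_nat_tsum fun m => μ {ω | R.h (m + 1) ω = o})
      (.inr ENNReal.ofReal_ne_top)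
    rwa [htsum, ENNReal.mul_top (ENNReal.ofReal_pos.2 hd).ne'] at h1
  exact (tendsto_add_atTop_iff_nat 1).1
    (tendsto_of_tendsto_of_tendsto_of_le_of_le hsum tendsto_const_nhds hlow fun _ => le_top)

end Randomness

end RemoteEst

/-! ### The stability criterion. -/

theorem theorem4 {N M K : ℕ} (hMN : M < N)
    (sensor : Fin N → RemoteEst.SensorModel)
    (horder : Antitone fun n => RemoteEst.specRad (sensor n).A)
    (c : RemoteEst.ChannelModel M K)
    {Ω : Type*} [MeasurableSpace Ω] (μ : Measure Ω) [IsProbabilityMeasure μ]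
    (R : RemoteEst.Randomness sensor c μ) :
    R.IsStabilizable ↔
      RemoteEst.specRad (sensor ⟨0, Nat.zero_lt_of_lt hMN⟩).A ^ 2 *
        RemoteEst.specRad c.offPart < 1 := by
  constructor
  · rintro ⟨π, hπ⟩
    by_contra hge
    have htop : R.avgMSE π ⟨0, Nat.zero_lt_of_lt hMN⟩ = ∞ :=
      RemoteEst.limsup_average_eq_top (R.tendsto_mse_nhds_top π _ (not_lt.1 hge))
    exact hπ.ne (ENNReal.sum_eq_top.2 ⟨_, Finset.mem_univ _, htop⟩)
  · intro hlt
    have : NeZero N := ⟨(Nat.zero_lt_of_lt hMN).ne'⟩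
    obtain ⟨q, r, hq, hr, hqr⟩ := RemoteEst.exists_rates (RemoteEst.specRad_ne_top _)
      (RemoteEst.specRad_ne_top _) hlt
    refine ⟨RemoteEst.maxAgePolicy N M K, ENNReal.sum_lt_top.2 fun n _ => ?_⟩
    -- Sensor `0` has the largest spectral radius, so one pair of rates serves all sensors.
    have hn : RemoteEst.specRad (sensor n).A < q :=
      (horder (show (⟨0, Nat.zero_lt_of_lt hMN⟩ : Fin N) ≤ n from Nat.zero_le _)).trans_lt hq
    obtain ⟨B, hB⟩ := R.exists_mse_maxAgePolicy_le n hn hr hqr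
    exact (RemoteEst.limsup_average_le hB).trans_lt ENNReal.coe_lt_top
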